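/- Let $(\mathcal A\times\mathcal B,\mu)$ be a finite joint probability space with marginals $\mu_A,\mu_B$. Let $$\rho=\sup\{\mathbb E_{(x,y)\sim\mu}[f(x)g(y)] : f:\mathcal A\to\mathbb R,\ g:\mathcal B\to\mathbb R,\ \mathbb E f=\mathbb E g=0,\ \operatorname{Var}f=\operatorname{Var}g=1\}$$ be its maximal correlation (with $\rho=0$ if there are no such $f,g$), and let $\alpha$ be the minimum non-zero probability of an atom of $\mu$. Let $\mathcal G(\rho)$ be the two-dimensional Gaussian distribution with mean $0$ and covariance matrix $\begin{pmatrix}1&\rho\\ \rho&1\end{pmatrix}$. For every $\zeta>0$ there is $w=w((\mathcal A\times\mathcal B,\mu),\zeta)\in\mathbb N$ such that the following holds for every $h\in\mathbb N$. Let $f_2:\mathcal A^h\times\mathbb R\to[-1,1]$ and $g_2:\mathcal B^h\times\mathbb R\to[-1,1]$ be such that for some $f_2':\mathcal A^h\to\mathbb R$ and $g_2':\mathcal B^h\to\mathbb R$, $$f_2(\mathbf x,r)=\begin{cases}1& r\ge f_2'(\mathbf x)\\-1& r<f_2'(\mathbf x)\end{cases}\qquad\text{and}\qquad g_2(\mathbf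 y,r)=\begin{cases}1& r\ge g_2'(\mathbf y)\\-1& r<g_2'(\mathbf y).\end{cases}$$ Then there are $f_3:\mathcal A^{h+w}\to[-1,1]$ and $g_3:\mathcal B^{h+w}\to[-1,1]$ with $$\Big|\mathbb E_{\mathbf x\sim\mu_A^{\otimes(h+w)}}f_3(\mathbf x)-\mathbb E_{\mathbf x\sim\mu_A^{\otimes h},\,r_A\sim\mathcal N(0,1)}f_2(\mathbf x,r_A)\Big|\le\zeta,$$ $$\Big|\mathbb E_{\mathbf y\sim\mu_B^{\otimes(h+w)}}g_3(\mathbf y)-\mathbb E_{\mathbf y\sim\mu_B^{\otimes h},\,r_B\sim\mathcal N(0,1)}g_2(\mathbf y,r_B)\Big|\le\zeta,$$ $$\Big|\mathbb E_{(\mathbf x,\mathbf y)\sim\mu^{\otimes(h+w)}}[f_3(\mathbf x)g_3(\mathbf y)]-\mathbb E_{(\mathbf x,\mathbf y)\sim\mu^{\otimes h},\,(r_A,r_B)\sim\mathcal G(\rho)}[f_2(\mathbf x,r_A)g_2(\mathbf y,r_B)]\Big|\le\zeta.$$ Moreover, there is an absolute constant $C>0$ such that whenever $\rho<1$, $w$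 may be taken with $$w\le C\cdot\frac{1+\rho}{\alpha(1-\rho)^3\zeta^2}.$$ -/

import Mathlib

open MeasureTheory ProbabilityTheory

noncomputable section

namespace WitsenhausenRounding

/-- The maximal correlation of a joint distribution `μ` on `A × B`: the supremum of `E[f(x) g(y)]`
over real functions `f`, `g` with mean zero and variance one under the two marginals. (If there is
no such pair, that is, if one marginal is a point mass, the value is `sSup ∅ = 0`, as usual.) -/
def maxCorr {A B : Type*} [MeasurableSpace A] [MeasurableSpace B] (μ : Measure (A × B)) : ℝ :=
  sSup {c : ℝ | ∃ (f : A → ℝ) (g : B → ℝ),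
    (∫ x, f x ∂μ.fst) = 0 ∧ (∫ y, g y ∂μ.snd) = 0 ∧
    Var[f; μ.fst] = 1 ∧ Var[g; μ.snd] = 1 ∧
    c = ∫ z, f z.1 * g z.2 ∂μ}

/-- The minimum non-zero probability of an atom under `μ` (meant for finite spaces). -/
def minAtom {Ω : Type*} [MeasurableSpace Ω] (μ : Measure Ω) : ℝ :=
  sInf {p : ℝ | 0 < p ∧ ∃ z : Ω, p = μ.real {z}}

/-- The law of a pair of centred jointly Gaussian variables with unit variances and
covariance `ρ`. -/
def corrGaussian (ρ : ℝ) : Measure (EuclideanSpace ℝ (Fin 2)) :=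
  multivariateGaussian 0 !![1, ρ; ρ, 1]

/-- `F (x, r)` is `1` if `r ≥ F' x` and `-1` if `r < F' x`, for some threshold function `F'`. -/
def IsThreshold {X : Type*} (F : X × ℝ → ℝ) : Prop :=
  ∃ F' : X → ℝ, ∀ x r, F (x, r) = if F' x ≤ r then 1 else -1

end WitsenhausenRounding

end

open scoped NNReal

noncomputable section

namespace WitsenhausenRounding

/-! Once the first `h` samples are fixed, `f₂` and `g₂` are threshold functions of two standard
Gaussians with covariance ρ. So it suffices to simulate such a pair from `w` fresh samples,
uniformly in the two thresholds (`IsSimulation`). Take normalized `f`, `g` with correlation c close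
to ρ. By the central limit theorem, signed sums of f(x_i) and g(y_i), scaled to variance 1 - δ,
resemble Gaussians with covariance (1 - δ)c. A private Gaussian of variance δ is added to each sum
and averaged out. This smooths the sign and leaves a [-1, 1]-valued function of the samples alone.

The comparison is Lindeberg's (`lindeberg`). Alternating signs group the samples into differences of
two independent copies, so third-order terms vanish and exchanging such a difference for a Gaussian
increment of equal covariance costs fourth moments only; these are O(1/α) by `integral_pow_four_le`.
A Gaussian increment is a common part, which carries the covariance, plus two private parts. The
private parts already substituted smooth the test functions further, so the j-th exchange costs a
multiple of 1/(δ + jτ')². For c < 1 the sum over the m exchanges is governed by 1/(mδ(1 - c)) once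
mδ is large.

It remains to move the covariance from (1 - δ)c to ρ. For ρ < 1 the private variance 1 - ρ makes
correlations Lipschitz in the covariance (`abs_corrHeat_sub_corrHeat_le`). For ρ = 1 this smoothing
is absent and anti-concentration at the thresholds replaces it (`abs_corrHeat_threshold_sub_le`).
With δ of order ζ(1 - ρ) and m of order 1/(αζ²(1 - ρ)²) all errors are at most ζ, and a factor 1 - ρ
is left over in the bound on `w`. -/

/-! ### Gaussian smoothing on the line and its derivatives. -/

/-- The heat semigroup: convolution with the centred Gaussian of variance `v`. -/
def heat (v : ℝ≥0) (f : ℝ → ℝ) (x : ℝ) : ℝ := ∫ n, f (x + n) ∂gaussianReal 0 v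

/-- The derivative of `heat v f`, written without derivatives of `f`. -/
def heatDeriv (v : ℝ≥0) (f : ℝ → ℝ) (x : ℝ) : ℝ := ∫ n, f (x + n) * (n / v) ∂gaussianReal 0 v

/-- Measurable functions on the line bounded by `M`. -/
structure IsBddMeas (f : ℝ → ℝ) (M : ℝ) : Prop where
  meas : Measurable f
  bound : ∀ x, |f x| ≤ M

lemma IsBddMeas.integrable_comp {Ω : Type*} [MeasurableSpace Ω] {P : Measure Ω} [IsFiniteMeasure P]
    {f : ℝ → ℝ} {M : ℝ} (hf : IsBddMeas f M) {X : Ω → ℝ} (hX : Measurable X) :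
    Integrable (fun ω => f (X ω)) P :=
  Integrable.of_bound (hf.meas.comp hX).aestronglyMeasurable M
    (.of_forall fun ω => hf.bound (X ω))

lemma IsBddMeas.integrable_mul {Ω : Type*} [MeasurableSpace Ω] {P : Measure Ω} [IsFiniteMeasure P]
    {f g : ℝ → ℝ} {M N : ℝ} (hf : IsBddMeas f M) (hg : IsBddMeas g N) {X Y : Ω → ℝ}
    (hX : Measurable X) (hY : Measurable Y) :
    Integrable (fun ω => f (X ω) * g (Y ω)) P := by
  refine Integrable.of_bound
    ((hf.meas.comp hX).mul (hg.meas.comp hY)).aestronglyMeasurable (M * N) (.of_forall fun ω => ?_)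
  rw [Real.norm_eq_abs, abs_mul]
  exact mul_le_mul (hf.bound _) (hg.bound _) (abs_nonneg _) ((abs_nonneg _).trans (hf.bound 0))

lemma IsBddMeas.nonneg {f : ℝ → ℝ} {M : ℝ} (hf : IsBddMeas f M) : 0 ≤ M :=
  (abs_nonneg _).trans (hf.bound 0)

lemma abs_integral_le_of_abs_le {Ω : Type*} [MeasurableSpace Ω] (P : Measure Ω)
    [IsProbabilityMeasure P] {f : Ω → ℝ} {M : ℝ} (h : ∀ ω, |f ω| ≤ M) : |∫ ω, f ω ∂P| ≤ M := by
  simpa using norm_integral_le_of_norm_le_const (μ := P) (f := f) (C := M) (.of_forall h)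

lemma heat_isBddMeas {f : ℝ → ℝ} {M : ℝ} (hf : IsBddMeas f M) (v : ℝ≥0) :
    IsBddMeas (heat v f) M where
  meas := by
    have : StronglyMeasurable (Function.uncurry fun x n : ℝ => f (x + n)) :=
      (hf.meas.comp (measurable_fst.add measurable_snd)).stronglyMeasurable
    exact this.integral_prod_right.measurable
  bound x := abs_integral_le_of_abs_le _ fun n => hf.bound _

lemma integral_sq_gaussianReal (v : ℝ≥0) : ∫ n, n ^ 2 ∂gaussianReal 0 v = v := by
  have h2 : MemLp (fun n : ℝ => n) 2 (gaussianReal 0 v) :=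
    memLp_id_gaussianReal' 2 (by simp)
  have := variance_eq_sub h2
  rw [variance_fun_id_gaussianReal] at this
  simpa using this.symm

lemma integral_abs_gaussianReal_le (v : ℝ≥0) : ∫ n, |n| ∂gaussianReal 0 v ≤ √v := by
  have h2 : MemLp (fun n : ℝ => n) 2 (gaussianReal 0 v) :=
    memLp_id_gaussianReal' 2 (by simp)
  have habs : MemLp (fun n : ℝ => |n|) 2 (gaussianReal 0 v) := h2.abs
  have hvar := variance_nonneg (fun n : ℝ => |n|) (gaussianReal 0 v)
  rw [variance_eq_sub habs] at hvar
  have hv' : ((fun n : ℝ => |n|) ^ 2) = fun n => n ^ 2 := by ext n; simp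
  rw [hv', integral_sq_gaussianReal] at hvar
  exact Real.le_sqrt_of_sq_le (by linarith)

lemma integrable_pow_gaussianReal (v : ℝ≥0) (k : ℕ) :
    Integrable (fun n : ℝ => n ^ k) (gaussianReal 0 v) := by
  have h : MemLp (fun n : ℝ => n) k (gaussianReal 0 v) :=
    memLp_id_gaussianReal' k (by simp)
  refine (integrable_norm_iff (by fun_prop)).1 ?_
  simpa only [norm_pow] using h.integrable_norm_pow'

/-- Each derivative costs a factor 1/√v, because E|n| ≤ √v. -/
lemma heatDeriv_isBddMeas {f : ℝ → ℝ} {M : ℝ} (hf : IsBddMeas f M) (v : ℝ≥0) :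
    IsBddMeas (heatDeriv v f) (M * (1 / √v)) where
  meas := by
    have : StronglyMeasurable (Function.uncurry fun x n : ℝ => f (x + n) * (n / v)) :=
      ((hf.meas.comp (measurable_fst.add measurable_snd)).mul
        (measurable_snd.div_const _)).stronglyMeasurable
    exact this.integral_prod_right.measurable
  bound x := by
    have hint : Integrable (fun n : ℝ => |n|) (gaussianReal 0 v) := by
      simpa using (integrable_pow_gaussianReal v 1).abs
    calc |heatDeriv v f x| ≤ ∫ n, |f (x + n) * (n / v)| ∂gaussianReal 0 v :=
          abs_integral_le_integral_abs
      _ ≤ ∫ n, M / v * |n| ∂gaussianReal 0 v := by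
          refine integral_mono_of_nonneg (.of_forall fun n => abs_nonneg _) (hint.const_mul _)
            (.of_forall fun n => ?_)
          simp only [abs_mul, abs_div, NNReal.abs_eq]
          rw [div_mul_eq_mul_div, mul_div_assoc]
          exact mul_le_mul_of_nonneg_right (hf.bound _) (by positivity)
      _ ≤ M / v * √v := by
          rw [integral_const_mul]
          exact mul_le_mul_of_nonneg_left (integral_abs_gaussianReal_le v)
            (div_nonneg hf.nonneg v.2)
      _ = M * (1 / √v) := by
          rw [div_mul_eq_mul_div, mul_div_assoc, Real.sqrt_div_self']

lemma heat_heat {f : ℝ → ℝ} {M : ℝ} (hf : IsBddMeas f M) (v w : ℝ≥0) :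
    heat v (heat w f) = heat (v + w) f := by
  ext x
  have h : gaussianReal 0 (v + w) = gaussianReal 0 v ∗ gaussianReal 0 w := by
    rw [gaussianReal_conv_gaussianReal, add_zero]
  unfold heat
  rw [h, integral_conv]
  · simp only [add_assoc]
  · exact hf.integrable_comp (measurable_const_add x)

lemma heat_zero (f : ℝ → ℝ) : heat 0 f = f := by
  ext x; simp [heat]

/-- Cameron–Martin shift: the translation moves from `f` onto the Gaussian density, so that
differentiation in t requires no regularity of `f`. -/
lemma heat_add_const (f : ℝ → ℝ) (v : ℝ≥0) (x t : ℝ) (hv : v ≠ 0) :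
    heat v f (x + t) =
      ∫ n, f (x + n) * Real.exp (n * t / v - t ^ 2 / (2 * v)) ∂gaussianReal 0 v := by
  have h1 : heat v f (x + t) = ∫ n, f (x + n) ∂gaussianReal t v := by
    have : gaussianReal t v = (gaussianReal 0 v).map (t + ·) := by
      rw [gaussianReal_map_const_add, zero_add]
    rw [this, (measurableEmbedding_addLeft t).integral_map]
    simp only [heat, add_assoc]
  have hv' : (v : ℝ) ≠ 0 := by exact_mod_cast hv
  rw [h1, integral_gaussianReal_eq_integral_smul hv, integral_gaussianReal_eq_integral_smul hv]
  congr 1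
  ext n
  simp only [gaussianPDFReal, smul_eq_mul]
  have : Real.exp (-(n - t) ^ 2 / (2 * v)) =
      Real.exp (-(n - 0) ^ 2 / (2 * v)) * Real.exp (n * t / v - t ^ 2 / (2 * v)) := by
    rw [← Real.exp_add]; congr 1; field_simp; ring
  rw [this]; ring

lemma hasDerivAt_heat {f : ℝ → ℝ} {M : ℝ} (hf : IsBddMeas f M) {v : ℝ≥0} (hv : v ≠ 0) (x : ℝ) :
    HasDerivAt (heat v f) (heatDeriv v f x) x := by
  have hv0 : (0 : ℝ) < v := by exact_mod_cast pos_iff_ne_zero.2 hv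
  have hmeas : ∀ t : ℝ, Measurable fun n : ℝ =>
      f (x + n) * Real.exp (n * t / v - t ^ 2 / (2 * v)) := fun t =>
    (hf.meas.comp (measurable_const_add x)).mul (by fun_prop)
  have key : HasDerivAt (fun t => heat v f (x + t)) (heatDeriv v f x) 0 := by
    rw [funext fun t => heat_add_const f v x t hv]
    have := (hasDerivAt_integral_of_dominated_loc_of_deriv_le (μ := gaussianReal 0 v)
      (F := fun t n => f (x + n) * Real.exp (n * t / v - t ^ 2 / (2 * v)))
      (F' := fun t n => f (x + n) * (Real.exp (n * t / v - t ^ 2 / (2 * v)) * (n / v - t / v)))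
      -- A multiple of exp((1 + 1/v)|n|) dominates for |t| ≤ 1; splitting it into two exponentials
      -- without absolute value gives Gaussian exponential moments.
      (bound := fun n => M / v * (Real.exp ((1 + 1 / v) * n) + Real.exp (-(1 + 1 / v) * n)))
      (x₀ := 0) (s := Metric.ball 0 1) (Metric.ball_mem_nhds 0 one_pos)
      (.of_forall fun t => (hmeas t).aestronglyMeasurable) ?_ ?_ ?_ ?_ ?_).2
    · convert! this using 1
      simp [heatDeriv]
    · simpa using hf.integrable_comp (measurable_const_add x)
    · exact ((hf.meas.comp (measurable_const_add x)).mul (by fun_prop)).aestronglyMeasurable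
    · refine .of_forall fun n t ht => ?_
      have ht1 : |t| ≤ 1 := by simpa using (Metric.mem_ball.1 ht).le
      rw [Real.norm_eq_abs, abs_mul, abs_mul, Real.abs_exp]
      have e1 : Real.exp (n * t / v - t ^ 2 / (2 * v)) ≤ Real.exp (|n| / v) := by
        apply Real.exp_le_exp.2
        have : n * t ≤ |n| := by
          calc n * t ≤ |n * t| := le_abs_self _
            _ = |n| * |t| := abs_mul _ _
            _ ≤ |n| * 1 := by gcongr
            _ = |n| := mul_one _
        have h2 : n * t / v ≤ |n| / v := by gcongr
        have h3 : 0 ≤ t ^ 2 / (2 * v) := by positivity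
        linarith
      have e2 : |n / v - t / v| ≤ Real.exp |n| / v := by
        rw [← sub_div, abs_div, abs_of_pos hv0]
        gcongr
        calc |n - t| ≤ |n| + |t| := abs_sub _ _
          _ ≤ |n| + 1 := by gcongr
          _ ≤ _ := Real.add_one_le_exp _
      have e3 : Real.exp ((1 + 1 / v) * |n|) ≤
          Real.exp ((1 + 1 / v) * n) + Real.exp (-(1 + 1 / v) * n) := by
        rcases abs_cases n with ⟨h, _⟩ | ⟨h, _⟩ <;> rw [h]
        · linarith [Real.exp_pos (-(1 + 1 / (v : ℝ)) * n)]
        · rw [mul_neg, ← neg_mul]; linarith [Real.exp_pos ((1 + 1 / (v : ℝ)) * n)]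
      calc |f (x + n)| * (Real.exp (n * t / v - t ^ 2 / (2 * v)) * |n / v - t / v|)
          ≤ M * (Real.exp (|n| / v) * (Real.exp |n| / v)) := by
            have := hf.nonneg
            gcongr
            exact hf.bound _
        _ = M / v * Real.exp ((1 + 1 / v) * |n|) := by
            have : (1 + 1 / (v : ℝ)) * |n| = |n| / v + |n| := by ring
            rw [this, Real.exp_add]; ring
        _ ≤ _ := mul_le_mul_of_nonneg_left e3 (div_nonneg hf.nonneg hv0.le)
    · exact ((integrable_exp_mul_gaussianReal _).add
        (integrable_exp_mul_gaussianReal _)).const_mul _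
    · refine .of_forall fun n t _ => ?_
      have h : HasDerivAt (fun t : ℝ => n * t / v - t ^ 2 / (2 * v)) (n / v - t / v) t := by
        have h1 := ((hasDerivAt_id t).const_mul n).div_const (v : ℝ)
        have h2 := (hasDerivAt_pow 2 t).div_const (2 * (v : ℝ))
        convert! h1.sub h2 using 1
        field_simp; push_cast; ring
      exact h.exp.const_mul _
  have h0 : HasDerivAt (fun y => heat v f (x + (y - x))) (heatDeriv v f x) x := by
    have := HasDerivAt.comp_sub_const (x := x) (a := x) (f := fun t => heat v f (x + t))
      (f' := heatDeriv v f x) (by simpa using key)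
    exact this
  simpa using h0

/-- For differentiable `f` the derivative passes through the kernel; this allows several kernels to
be stacked for higher derivatives. -/
lemma hasDerivAt_heatDeriv {f f' : ℝ → ℝ} {M M' : ℝ} (hf : IsBddMeas f M) (hf' : IsBddMeas f' M')
    (hd : ∀ x, HasDerivAt f (f' x) x) (v : ℝ≥0) (x : ℝ) :
    HasDerivAt (heatDeriv v f) (heatDeriv v f' x) x := by
  have hint : Integrable (fun n : ℝ => |n / v|) (gaussianReal 0 v) := by
    have : Integrable (fun n : ℝ => n) (gaussianReal 0 v) := by
      simpa using integrable_pow_gaussianReal v 1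
    exact (this.div_const _).abs
  have hm : ∀ {g : ℝ → ℝ} {N : ℝ}, IsBddMeas g N → ∀ y, AEStronglyMeasurable
      (fun n : ℝ => g (y + n) * (n / v)) (gaussianReal 0 v) := fun hg y =>
    ((hg.meas.comp (measurable_const_add y)).mul (by fun_prop)).aestronglyMeasurable
  refine (hasDerivAt_integral_of_dominated_loc_of_deriv_le (μ := gaussianReal 0 v)
      (F := fun t n => f (t + n) * (n / v)) (F' := fun t n => f' (t + n) * (n / v))
      (bound := fun n => M' * |n / v|) (x₀ := x) (s := Set.univ) Filter.univ_mem
      (.of_forall fun t => hm hf t) ?_ (hm hf' x) ?_ (hint.const_mul _) ?_).2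
  · refine (hint.const_mul M).mono' (hm hf x) (.of_forall fun n => ?_)
    rw [Real.norm_eq_abs, abs_mul]
    exact mul_le_mul_of_nonneg_right (hf.bound _) (abs_nonneg _)
  · refine .of_forall fun n t _ => ?_
    rw [Real.norm_eq_abs, abs_mul]
    exact mul_le_mul_of_nonneg_right (hf'.bound _) (abs_nonneg _)
  · refine .of_forall fun n t _ => ?_
    exact ((hd (t + n)).comp_add_const t n).mul_const _

lemma iterate_heatDeriv_isBddMeas {f : ℝ → ℝ} {M : ℝ} (hf : IsBddMeas f M) (v : ℝ≥0) (k : ℕ) :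
    IsBddMeas ((heatDeriv v)^[k] f) (M * (1 / √v) ^ k) := by
  induction k with
  | zero => simpa using hf
  | succ k ih =>
    rw [Function.iterate_succ_apply', pow_succ, ← mul_assoc]
    exact heatDeriv_isBddMeas ih v

lemma hasDerivAt_iterate_heatDeriv {f : ℝ → ℝ} {M : ℝ} (hf : IsBddMeas f M) {v : ℝ≥0} (hv : v ≠ 0)
    (k : ℕ) (x : ℝ) :
    HasDerivAt ((heatDeriv v)^[k] (heat v f)) ((heatDeriv v)^[k + 1] f x) x := by
  induction k generalizing x with
  | zero => exact hasDerivAt_heat hf hv x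
  | succ k ih =>
    rw [Function.iterate_succ_apply', Function.iterate_succ_apply' (heatDeriv v) (k + 1)]
    exact hasDerivAt_heatDeriv (iterate_heatDeriv_isBddMeas (heat_isBddMeas hf v) v k)
      (iterate_heatDeriv_isBddMeas hf v (k + 1)) ih v x

lemma iterate_heat_isBddMeas {f : ℝ → ℝ} {M : ℝ} (hf : IsBddMeas f M) (v : ℝ≥0) (k : ℕ) :
    IsBddMeas ((heat v)^[k] f) M := by
  induction k with
  | zero => exact hf
  | succ k ih =>
    rw [Function.iterate_succ_apply']
    exact heat_isBddMeas ih v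

/-- `U` lists a function and its first four derivatives, the `k`-th bounded by `K ^ k`. -/
structure IsDerivChain (U : ℕ → ℝ → ℝ) (K : ℝ) : Prop where
  bddMeas : ∀ k ≤ 4, IsBddMeas (U k) (K ^ k)
  hasDerivAt : ∀ k < 4, ∀ x, HasDerivAt (U k) (U (k + 1) x) x

lemma exists_isDerivChain_heat {f : ℝ → ℝ} (hf : IsBddMeas f 1) {v : ℝ≥0} (hv : v ≠ 0) :
    ∃ U : ℕ → ℝ → ℝ, U 0 = heat v f ∧ IsDerivChain U (2 / √v) := by
  -- The variance is split into four quarters; each derivative uses one quarter, and the remaining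
  -- `4 - k` act as plain smoothing.
  have hv4 : v / 4 ≠ 0 := div_ne_zero hv (by norm_num)
  have hK : 1 / √((v / 4 : ℝ≥0) : ℝ) = 2 / √v := by
    rw [NNReal.coe_div, Real.sqrt_div v.coe_nonneg, show ((4 : ℝ≥0) : ℝ) = 4 from rfl, show (4 : ℝ) = 2 ^ 2 by norm_num, Real.sqrt_sq (by norm_num)]
    simp
  refine ⟨fun k => (heatDeriv (v / 4))^[k] ((heat (v / 4))^[4 - k] f), ?_, ?_, ?_⟩
  · simp only [Function.iterate_zero, id, Nat.sub_zero]
    have h2 := heat_heat hf (v / 4) (v / 4)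
    have h3 := heat_heat hf (v / 4) (v / 4 + v / 4)
    have h4 := heat_heat hf (v / 4) (v / 4 + (v / 4 + v / 4))
    have hs : v / 4 + (v / 4 + (v / 4 + v / 4)) = v := by
      apply NNReal.eq; push_cast; ring
    rw [hs, ← h3, ← h2] at h4
    exact h4
  · intro k _
    have := iterate_heatDeriv_isBddMeas (iterate_heat_isBddMeas hf (v / 4) (4 - k)) (v / 4) k
    rwa [hK, one_mul] at this
  · intro k hk x
    have := hasDerivAt_iterate_heatDeriv (iterate_heat_isBddMeas hf (v / 4) (4 - (k + 1))) hv4 k x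
    rw [← Function.iterate_succ_apply' (heat (v / 4)),
      show (4 - (k + 1)).succ = 4 - k by omega] at this
    exact this

/-! ### Taylor expansion under symmetric increments. -/

lemma abs_le_of_abs_deriv_le {f f' : ℝ → ℝ} {K : ℝ} (hd : ∀ t, HasDerivAt f (f' t) t)
    (h0 : f 0 = 0) (hb : ∀ t ∈ Set.Icc (0 : ℝ) 1, |f' t| ≤ K) :
    ∀ t ∈ Set.Icc (0 : ℝ) 1, |f t| ≤ K := by
  intro t ht
  have h := (convex_Icc (0 : ℝ) 1).norm_image_sub_le_of_norm_hasDerivWithin_le (C := K)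
    (fun s _ => (hd s).hasDerivWithinAt) (fun s hs => hb s hs)
    (Set.left_mem_Icc.2 zero_le_one) ht
  rw [h0, sub_zero, sub_zero, Real.norm_eq_abs, Real.norm_eq_abs, abs_of_nonneg ht.1] at h
  have hK : 0 ≤ K := (abs_nonneg _).trans (hb t ht)
  nlinarith [ht.2]

/-- In φ(t) + φ(-t) the odd derivatives at 0 cancel. Four integrations over [0, 1] from the fourth
derivative bound the remainder; the factor 1/24 is given away. -/
lemma symmetric_taylor {φ : ℕ → ℝ → ℝ} {M : ℝ}
    (hd : ∀ k < 4, ∀ t, HasDerivAt (φ k) (φ (k + 1) t) t) (hb : ∀ t, |φ 4 t| ≤ M) :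
    |(φ 0 1 + φ 0 (-1)) / 2 - (φ 0 0 + φ 2 0 / 2)| ≤ M := by
  have hn : ∀ k < 4, ∀ t, HasDerivAt (fun t => φ k (-t)) (-φ (k + 1) (-t)) t := fun k hk t => by
    convert! (hd k hk (-t)).comp t (hasDerivAt_neg t) using 1
    simp
  have d0 : ∀ t, HasDerivAt (fun t => φ 0 t + φ 0 (-t) - 2 * φ 0 0 - t ^ 2 * φ 2 0)
      (φ 1 t - φ 1 (-t) - 2 * t * φ 2 0) t := fun t => by
    convert! (((hd 0 (by norm_num) t).add (hn 0 (by norm_num) t)).sub_const (2 * φ 0 0)).sub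
      ((hasDerivAt_pow 2 t).mul_const (φ 2 0)) using 1
    norm_num; ring
  have d1 : ∀ t, HasDerivAt (fun t => φ 1 t - φ 1 (-t) - 2 * t * φ 2 0)
      (φ 2 t + φ 2 (-t) - 2 * φ 2 0) t := fun t => by
    convert! ((hd 1 (by norm_num) t).sub (hn 1 (by norm_num) t)).sub
      (((hasDerivAt_id t).const_mul 2).mul_const (φ 2 0)) using 1
    norm_num
  have d2 : ∀ t, HasDerivAt (fun t => φ 2 t + φ 2 (-t) - 2 * φ 2 0) (φ 3 t - φ 3 (-t)) t :=
    fun t => by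
    convert! ((hd 2 (by norm_num) t).add (hn 2 (by norm_num) t)).sub_const (2 * φ 2 0) using 1
  have d3 : ∀ t, HasDerivAt (fun t => φ 3 t - φ 3 (-t)) (φ 4 t + φ 4 (-t)) t := fun t => by
    convert! (hd 3 (by norm_num) t).sub (hn 3 (by norm_num) t) using 1
    simp
  have b4 : ∀ t ∈ Set.Icc (0 : ℝ) 1, |φ 4 t + φ 4 (-t)| ≤ 2 * M := fun t _ =>
    (abs_add_le _ _).trans (by linarith [hb t, hb (-t)])
  have b3 := abs_le_of_abs_deriv_le d3 (by simp) b4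
  have b2 := abs_le_of_abs_deriv_le d2 (by simp; ring) b3
  have b1 := abs_le_of_abs_deriv_le d1 (by simp) b2
  have b0 := abs_le_of_abs_deriv_le d0 (by simp; ring) b1 1 (by simp)
  rw [abs_le] at b0 ⊢
  constructor <;> linarith

/-- The second-order part at `(p, q)` of the product of two functions. -/
def quadPart (U V : ℕ → ℝ → ℝ) (p q a b c : ℝ) : ℝ :=
  U 2 p * V 0 q * a + 2 * (U 1 p * V 1 q) * b + U 0 p * V 2 q * c

lemma IsDerivChain.symmetric_taylor {U V : ℕ → ℝ → ℝ} {K : ℝ} (hU : IsDerivChain U K)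
    (hV : IsDerivChain V K) (p q x y : ℝ) :
    |(U 0 (p + x) * V 0 (q + y) + U 0 (p + -x) * V 0 (q + -y)) / 2 -
      (U 0 p * V 0 q + quadPart U V p q (x ^ 2) (x * y) (y ^ 2) / 2)| ≤
      8 * K ^ 4 * (x ^ 4 + y ^ 4) := by
  have hu : ∀ k < 4, ∀ t, HasDerivAt (fun t => U k (p + t * x)) (U (k + 1) (p + t * x) * x) t :=
    fun k hk t => by
    convert! (hU.hasDerivAt k hk (p + t * x)).comp t
      (((hasDerivAt_id t).mul_const x).const_add p) using 1
    simp
  have hv : ∀ k < 4, ∀ t, HasDerivAt (fun t => V k (q + t * y)) (V (k + 1) (q + t * y) * y) t :=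
    fun k hk t => by
    convert! (hV.hasDerivAt k hk (q + t * y)).comp t
      (((hasDerivAt_id t).mul_const y).const_add q) using 1
    simp
  have hK : 0 ≤ K := by simpa using (hU.bddMeas 1 (by norm_num)).nonneg
  -- Leibniz formula for the k-th derivative of t ↦ U(p + tx) V(q + ty).
  let φ : ℕ → ℝ → ℝ := fun k t => ∑ j ∈ Finset.range (k + 1),
    (k.choose j : ℝ) * (x ^ j * y ^ (k - j)) * (U j (p + t * x) * V (k - j) (q + t * y))
  have hd : ∀ k < 4, ∀ t, HasDerivAt (φ k) (φ (k + 1) t) t := by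
    intro k hk t
    have h1 : HasDerivAt (φ k) (∑ j ∈ Finset.range (k + 1),
        (k.choose j : ℝ) * (x ^ j * y ^ (k - j)) *
          (U (j + 1) (p + t * x) * x * V (k - j) (q + t * y) +
            U j (p + t * x) * (V (k - j + 1) (q + t * y) * y))) t := by
      refine HasDerivAt.fun_sum fun j hj => ?_
      have hj' := Finset.mem_range.1 hj
      exact ((hu j (by omega) t).mul (hv (k - j) (by omega) t)).const_mul _
    convert! h1 using 1
    interval_cases k <;> simp [φ, Finset.sum_range_succ, Nat.choose] <;> ring
  have hb : ∀ t, |φ 4 t| ≤ 8 * K ^ 4 * (x ^ 4 + y ^ 4) := by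
    intro t
    have hterm : ∀ j ≤ 4, |U j (p + t * x) * V (4 - j) (q + t * y)| ≤ K ^ 4 := by
      intro j hj
      rw [abs_mul]
      calc _ ≤ K ^ j * K ^ (4 - j) :=
            mul_le_mul ((hU.bddMeas j hj).bound _) ((hV.bddMeas (4 - j) (by omega)).bound _)
              (abs_nonneg _) (by positivity)
        _ = K ^ 4 := by rw [← pow_add]; congr 1; omega
    calc |φ 4 t| ≤ ∑ j ∈ Finset.range 5, (Nat.choose 4 j : ℝ) * (|x| ^ j * |y| ^ (4 - j)) * K ^ 4 := by
          refine (Finset.abs_sum_le_sum_abs _ _).trans (Finset.sum_le_sum fun j hj => ?_)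
          have hj' := Finset.mem_range.1 hj
          rw [abs_mul, abs_mul, abs_mul, abs_pow, abs_pow, Nat.abs_cast]
          exact mul_le_mul_of_nonneg_left (hterm j (by omega)) (by positivity)
      _ = K ^ 4 * (|x| + |y|) ^ 4 := by
          simp [Finset.sum_range_succ, Nat.choose, -sq_abs]; ring
      -- Convexity of the fourth power: (s + t)⁴ ≤ 2³ (s⁴ + t⁴).
      _ ≤ K ^ 4 * (8 * (|x| ^ 4 + |y| ^ 4)) := by
          refine mul_le_mul_of_nonneg_left ?_ (by positivity)
          have h2 := add_pow_le (abs_nonneg x) (abs_nonneg y) 4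
          norm_num at h2 ⊢
          linarith
      _ = _ := by
          rw [← abs_pow, ← abs_pow, abs_of_nonneg (by positivity : 0 ≤ x ^ 4),
            abs_of_nonneg (by positivity : 0 ≤ y ^ 4)]
          ring
  have := WitsenhausenRounding.symmetric_taylor hd hb
  convert this using 3
  all_goals
    simp [φ, quadPart, Finset.sum_range_succ, Nat.choose] <;> ring

/-- A symmetric law on the plane with finite fourth moments, equal variances `a`,
covariance `b`, and sum of the fourth moments at most `M`. -/
structure IsSymmStep (ν : Measure (ℝ × ℝ)) (a b M : ℝ) : Prop where
  map_neg : ν.map (fun z => -z) = ν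
  memLp_fst : MemLp (fun z : ℝ × ℝ => z.1) 4 ν
  memLp_snd : MemLp (fun z : ℝ × ℝ => z.2) 4 ν
  sq_fst : ∫ z, z.1 ^ 2 ∂ν = a
  sq_snd : ∫ z, z.2 ^ 2 ∂ν = a
  mul : ∫ z, z.1 * z.2 ∂ν = b
  fourth : ∫ z, (z.1 ^ 4 + z.2 ^ 4) ∂ν ≤ M

/-- By symmetry the integrand may be averaged over z and -z. Only second moments then enter the main
term, so two laws with the same `a` and `b` are interchangeable up to fourth moments. -/
lemma IsSymmStep.abs_integral_sub_le {ν : Measure (ℝ × ℝ)} [IsProbabilityMeasure ν] {a b M : ℝ}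
    (hν : IsSymmStep ν a b M) {U V : ℕ → ℝ → ℝ} {K : ℝ} (hU : IsDerivChain U K)
    (hV : IsDerivChain V K) (p q : ℝ) :
    |∫ z, U 0 (p + z.1) * V 0 (q + z.2) ∂ν - (U 0 p * V 0 q + quadPart U V p q a b a / 2)| ≤
      8 * K ^ 4 * M := by
  have hU0 := hU.bddMeas 0 (by norm_num)
  have hV0 := hV.bddMeas 0 (by norm_num)
  have i1 : Integrable (fun z : ℝ × ℝ => U 0 (p + z.1) * V 0 (q + z.2)) ν :=
    hU0.integrable_mul hV0 (by fun_prop) (by fun_prop)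
  have i2 : Integrable (fun z : ℝ × ℝ => U 0 (p + -z.1) * V 0 (q + -z.2)) ν :=
    hU0.integrable_mul hV0 (by fun_prop) (by fun_prop)
  have hsym : ∫ z, U 0 (p + -z.1) * V 0 (q + -z.2) ∂ν = ∫ z, U 0 (p + z.1) * V 0 (q + z.2) ∂ν := by
    conv_rhs => rw [← hν.map_neg]
    rw [integral_map (by fun_prop)]
    · rfl
    · exact ((hU0.meas.comp (by fun_prop)).mul (hV0.meas.comp (by fun_prop))).aestronglyMeasurable
  have m1 := hν.memLp_fst.mono_exponent (p := 2) (by norm_num)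
  have m2 := hν.memLp_snd.mono_exponent (p := 2) (by norm_num)
  have j1 : Integrable (fun z : ℝ × ℝ => z.1 ^ 2) ν := m1.integrable_sq
  have j2 : Integrable (fun z : ℝ × ℝ => z.2 ^ 2) ν := m2.integrable_sq
  have j3 : Integrable (fun z : ℝ × ℝ => z.1 * z.2) ν := m1.integrable_mul m2
  have j4 : Integrable (fun z : ℝ × ℝ => z.1 ^ 4 + z.2 ^ 4) ν := by
    have h1 := hν.memLp_fst.integrable_norm_pow (by norm_num)
    have h2 := hν.memLp_snd.integrable_norm_pow (by norm_num)
    have e : ∀ x : ℝ, ‖x‖ ^ 4 = x ^ 4 := fun x => by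
      rw [Real.norm_eq_abs, ← abs_pow, abs_of_nonneg (by positivity)]
    simp only [e] at h1 h2
    exact h1.add h2
  have hq : Integrable (fun z : ℝ × ℝ => quadPart U V p q (z.1 ^ 2) (z.1 * z.2) (z.2 ^ 2)) ν :=
    ((j1.const_mul _).add (j3.const_mul _)).add (j2.const_mul _)
  have hqi : ∫ z, quadPart U V p q (z.1 ^ 2) (z.1 * z.2) (z.2 ^ 2) ∂ν = quadPart U V p q a b a := by
    have h12 : Integrable (fun z : ℝ × ℝ => U 2 p * V 0 q * z.1 ^ 2 +
        2 * (U 1 p * V 1 q) * (z.1 * z.2)) ν := (j1.const_mul _).add (j3.const_mul _)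
    simp only [quadPart]
    rw [integral_add h12 (j2.const_mul _),
      integral_add (j1.const_mul _) (j3.const_mul _), integral_const_mul, integral_const_mul,
      integral_const_mul, hν.sq_fst, hν.sq_snd, hν.mul]
  have hmain : ∫ z, U 0 (p + z.1) * V 0 (q + z.2) ∂ν -
      (U 0 p * V 0 q + quadPart U V p q a b a / 2) =
      ∫ z, ((U 0 (p + z.1) * V 0 (q + z.2) + U 0 (p + -z.1) * V 0 (q + -z.2)) / 2 -
        (U 0 p * V 0 q + quadPart U V p q (z.1 ^ 2) (z.1 * z.2) (z.2 ^ 2) / 2)) ∂ν := by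
    have h12 : Integrable (fun z : ℝ × ℝ => (U 0 (p + z.1) * V 0 (q + z.2) +
        U 0 (p + -z.1) * V 0 (q + -z.2)) / 2) ν := (i1.add i2).div_const 2
    have h3 : Integrable (fun z : ℝ × ℝ => U 0 p * V 0 q +
        quadPart U V p q (z.1 ^ 2) (z.1 * z.2) (z.2 ^ 2) / 2) ν :=
      (integrable_const _).add (hq.div_const 2)
    rw [integral_sub h12 h3,
      integral_div, integral_add i1 i2, hsym, integral_add (integrable_const _) (hq.div_const 2),
      integral_div, hqi]
    simp
  rw [hmain]
  calc _ ≤ ∫ z, |(U 0 (p + z.1) * V 0 (q + z.2) + U 0 (p + -z.1) * V 0 (q + -z.2)) / 2 -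
        (U 0 p * V 0 q + quadPart U V p q (z.1 ^ 2) (z.1 * z.2) (z.2 ^ 2) / 2)| ∂ν :=
        abs_integral_le_integral_abs
    _ ≤ ∫ z, 8 * K ^ 4 * (z.1 ^ 4 + z.2 ^ 4) ∂ν :=
        integral_mono_of_nonneg (.of_forall fun _ => abs_nonneg _) (j4.const_mul _)
          (.of_forall fun z => hU.symmetric_taylor hV p q z.1 z.2)
    _ ≤ 8 * K ^ 4 * M := by
        rw [integral_const_mul]
        exact mul_le_mul_of_nonneg_left hν.fourth (by positivity)

/-! ### Correlated Gaussian pairs built from common and private noise. -/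

/-- The law of `(Z + N, Z + N')` for independent centred Gaussians `Z` of variance `κ`
and `N`, `N'` of variance `τ`. -/
def pairGaussian (κ τ : ℝ≥0) : Measure (ℝ × ℝ) :=
  ((gaussianReal 0 κ).prod ((gaussianReal 0 τ).prod (gaussianReal 0 τ))).map
    fun p => (p.1 + p.2.1, p.1 + p.2.2)

instance (κ τ : ℝ≥0) : IsProbabilityMeasure (pairGaussian κ τ) :=
  Measure.isProbabilityMeasure_map (by fun_prop)

/-- The average of `u (x + ·) v (y + ·)` under `pairGaussian κ τ`. -/
def corrHeat (κ τ : ℝ≥0) (u v : ℝ → ℝ) (p : ℝ × ℝ) : ℝ :=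
  ∫ z, heat τ u (p.1 + z) * heat τ v (p.2 + z) ∂gaussianReal 0 κ

/-- Given the common part Z, the private parts are independent and integrate out to `heat τ` of each
factor. -/
lemma integral_pairGaussian {u v : ℝ → ℝ} {M N : ℝ} (hu : IsBddMeas u M) (hv : IsBddMeas v N)
    (κ τ : ℝ≥0) (p q : ℝ) :
    ∫ w, u (p + w.1) * v (q + w.2) ∂pairGaussian κ τ = corrHeat κ τ u v (p, q) := by
  have hm : Measurable fun w : ℝ × ℝ => u (p + w.1) * v (q + w.2) :=
    (hu.meas.comp (by fun_prop)).mul (hv.meas.comp (by fun_prop))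
  rw [pairGaussian, integral_map (by fun_prop) hm.aestronglyMeasurable,
    integral_prod _ (hu.integrable_mul hv (by fun_prop) (by fun_prop))]
  refine integral_congr_ae (.of_forall fun z => ?_)
  simp only [heat, ← add_assoc]
  rw [← integral_prod_mul]

lemma map_fst_pairGaussian (κ τ : ℝ≥0) :
    (pairGaussian κ τ).map Prod.fst = gaussianReal 0 (κ + τ) := by
  have h : gaussianReal 0 (κ + τ) = gaussianReal 0 κ ∗ gaussianReal 0 τ := by
    rw [gaussianReal_conv_gaussianReal, add_zero]
  have h2 : (gaussianReal 0 κ).prod (gaussianReal 0 τ) =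
      ((gaussianReal 0 κ).prod ((gaussianReal 0 τ).prod (gaussianReal 0 τ))).map
        (Prod.map id Prod.fst) := by
    rw [← Measure.map_prod_map _ _ measurable_id measurable_fst, Measure.map_id]
    congr 1
    exact (measurePreserving_fst (μ := gaussianReal 0 τ) (ν := gaussianReal 0 τ)).map_eq.symm
  rw [h, Measure.conv, h2, pairGaussian, Measure.map_map (by fun_prop) (by fun_prop),
    Measure.map_map (by fun_prop) (by fun_prop)]
  rfl

lemma map_swap_pairGaussian (κ τ : ℝ≥0) :
    (pairGaussian κ τ).map Prod.swap = pairGaussian κ τ := by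
  have h : ((gaussianReal 0 κ).prod ((gaussianReal 0 τ).prod (gaussianReal 0 τ))).map
      (Prod.map id Prod.swap) = (gaussianReal 0 κ).prod ((gaussianReal 0 τ).prod (gaussianReal 0 τ)) := by
    rw [← Measure.map_prod_map _ _ measurable_id measurable_swap, Measure.map_id,
      Measure.prod_swap]
  conv_rhs => rw [pairGaussian, ← h]
  rw [pairGaussian, Measure.map_map (by fun_prop) (by fun_prop),
    Measure.map_map (by fun_prop) (by fun_prop)]
  rfl

lemma map_snd_pairGaussian (κ τ : ℝ≥0) :
    (pairGaussian κ τ).map Prod.snd = gaussianReal 0 (κ + τ) := by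
  rw [← map_fst_pairGaussian, ← map_swap_pairGaussian, Measure.map_map (by fun_prop) (by fun_prop),
    map_swap_pairGaussian]
  rfl

lemma map_neg_pairGaussian (κ τ : ℝ≥0) :
    (pairGaussian κ τ).map (fun z => -z) = pairGaussian κ τ := by
  have hn : ∀ v, (gaussianReal 0 v).map (fun x => -x) = gaussianReal 0 v := fun v => by
    rw [gaussianReal_map_neg, neg_zero]
  have h : ((gaussianReal 0 κ).prod ((gaussianReal 0 τ).prod (gaussianReal 0 τ))).map
      (Prod.map (fun x => -x) (Prod.map (fun x => -x) (fun x => -x))) =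
      (gaussianReal 0 κ).prod ((gaussianReal 0 τ).prod (gaussianReal 0 τ)) := by
    rw [← Measure.map_prod_map _ _ (by fun_prop) (by fun_prop),
      ← Measure.map_prod_map _ _ (by fun_prop) (by fun_prop), hn, hn]
  conv_rhs => rw [pairGaussian, ← h]
  rw [pairGaussian, Measure.map_map (by fun_prop) (by fun_prop),
    Measure.map_map (by fun_prop) (by fun_prop)]
  congr 1
  ext p <;> simp <;> ring

lemma integral_pairGaussian_mul (κ τ : ℝ≥0) : ∫ z, z.1 * z.2 ∂pairGaussian κ τ = κ := by
  have i1 : ∀ v, Integrable (fun x : ℝ => x) (gaussianReal 0 v) := fun v => by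
    simpa using integrable_pow_gaussianReal v 1
  have i2 : ∀ v, Integrable (fun x : ℝ => x ^ 2) (gaussianReal 0 v) := fun v =>
    integrable_pow_gaussianReal v 2
  rw [pairGaussian, integral_map (by fun_prop) (by fun_prop)]
  have e : ∀ p : ℝ × ℝ × ℝ, (p.1 + p.2.1) * (p.1 + p.2.2) =
      (p.1 ^ 2 + p.1 * (p.2.1 + p.2.2)) + p.2.1 * p.2.2 := fun p => by ring
  simp only [e]
  have hs : Integrable (fun q : ℝ × ℝ => q.1 + q.2) ((gaussianReal 0 τ).prod (gaussianReal 0 τ)) :=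
    ((i1 τ).comp_fst _).add ((i1 τ).comp_snd _)
  have a1 : Integrable (fun p : ℝ × ℝ × ℝ => p.1 ^ 2)
      ((gaussianReal 0 κ).prod ((gaussianReal 0 τ).prod (gaussianReal 0 τ))) :=
    (i2 κ).comp_fst _
  have a2 : Integrable (fun p : ℝ × ℝ × ℝ => p.1 * (p.2.1 + p.2.2))
      ((gaussianReal 0 κ).prod ((gaussianReal 0 τ).prod (gaussianReal 0 τ))) :=
    (i1 κ).mul_prod hs
  have a3 : Integrable (fun p : ℝ × ℝ × ℝ => p.2.1 * p.2.2)
      ((gaussianReal 0 κ).prod ((gaussianReal 0 τ).prod (gaussianReal 0 τ))) :=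
    Integrable.comp_snd (f := fun q : ℝ × ℝ => q.1 * q.2) ((i1 τ).mul_prod (i1 τ)) _
  have a12 : Integrable (fun p : ℝ × ℝ × ℝ => p.1 ^ 2 + p.1 * (p.2.1 + p.2.2))
      ((gaussianReal 0 κ).prod ((gaussianReal 0 τ).prod (gaussianReal 0 τ))) := a1.add a2
  have b1 : ∫ p : ℝ × ℝ × ℝ, p.1 ^ 2
      ∂((gaussianReal 0 κ).prod ((gaussianReal 0 τ).prod (gaussianReal 0 τ))) = κ := by
    rw [integral_prod _ a1]
    simp [integral_sq_gaussianReal]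
  have b2 : ∫ p : ℝ × ℝ × ℝ, p.1 * (p.2.1 + p.2.2)
      ∂((gaussianReal 0 κ).prod ((gaussianReal 0 τ).prod (gaussianReal 0 τ))) = 0 := by
    rw [integral_prod_mul (fun x : ℝ => x) (fun q : ℝ × ℝ => q.1 + q.2)]
    simp
  have b3 : ∫ p : ℝ × ℝ × ℝ, p.2.1 * p.2.2
      ∂((gaussianReal 0 κ).prod ((gaussianReal 0 τ).prod (gaussianReal 0 τ))) = 0 := by
    rw [integral_prod _ a3]
    simp only [integral_prod_mul (fun x : ℝ => x) (fun x : ℝ => x)]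
    simp
  rw [integral_add a12 a3, integral_add a1 a2, b1, b2, b3]
  simp

/-- The fourth moment of a standard Gaussian. -/
def gaussianFourth : ℝ := ∫ x, x ^ 4 ∂gaussianReal 0 1

lemma gaussianFourth_nonneg : 0 ≤ gaussianFourth :=
  integral_nonneg fun x => by positivity

/-- Only the scaling in v matters, so the standard fourth moment stays unevaluated. -/
lemma integral_pow_four_gaussianReal (v : ℝ≥0) :
    ∫ x, x ^ 4 ∂gaussianReal 0 v = gaussianFourth * v ^ 2 := by
  have h : gaussianReal 0 v = (gaussianReal 0 1).map (√v * ·) := by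
    rw [gaussianReal_map_const_mul, mul_zero, mul_one]
    congr 1
    exact NNReal.eq (by simp)
  rw [h, integral_map (by fun_prop) (by fun_prop)]
  simp only [mul_pow]
  rw [integral_const_mul, gaussianFourth, mul_comm, show (√(v : ℝ)) ^ 4 = ((√(v : ℝ)) ^ 2) ^ 2 by ring,
    Real.sq_sqrt v.coe_nonneg]

lemma isSymmStep_pairGaussian (κ τ : ℝ≥0) :
    IsSymmStep (pairGaussian κ τ) (κ + τ) κ (2 * gaussianFourth * ((κ : ℝ) + τ) ^ 2) := by
  have hp : ∀ k : ℕ, ∀ {g : ℝ × ℝ → ℝ}, Measurable g →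
      (pairGaussian κ τ).map g = gaussianReal 0 (κ + τ) →
      ∫ z, g z ^ k ∂pairGaussian κ τ = ∫ x, x ^ k ∂gaussianReal 0 (κ + τ) := by
    intro k g hg h
    rw [← h, integral_map hg.aemeasurable (by fun_prop)]
  have hm : ∀ {g : ℝ × ℝ → ℝ}, Measurable g →
      (pairGaussian κ τ).map g = gaussianReal 0 (κ + τ) → MemLp g 4 (pairGaussian κ τ) := by
    intro g hg h
    have : MemLp (fun x : ℝ => x) 4 ((pairGaussian κ τ).map g) := by
      rw [h]; exact memLp_id_gaussianReal' 4 (by simp)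
    exact (memLp_map_measure_iff (by fun_prop) hg.aemeasurable).1 this
  have h1 := map_fst_pairGaussian κ τ
  have h2 := map_snd_pairGaussian κ τ
  refine ⟨map_neg_pairGaussian κ τ, hm measurable_fst h1, hm measurable_snd h2, ?_, ?_,
    integral_pairGaussian_mul κ τ, ?_⟩
  · rw [hp 2 measurable_fst h1, integral_sq_gaussianReal, NNReal.coe_add]
  · rw [hp 2 measurable_snd h2, integral_sq_gaussianReal, NNReal.coe_add]
  · have i : ∀ {g : ℝ × ℝ → ℝ}, Measurable g →
        (pairGaussian κ τ).map g = gaussianReal 0 (κ + τ) →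
        Integrable (fun z => g z ^ 4) (pairGaussian κ τ) := by
      intro g hg h
      have := integrable_pow_gaussianReal (κ + τ) 4
      rw [← h] at this
      exact this.comp_measurable hg
    rw [integral_add (i measurable_fst h1) (i measurable_snd h2), hp 4 measurable_fst h1,
      hp 4 measurable_snd h2, integral_pow_four_gaussianReal, NNReal.coe_add]
    linarith

lemma IsBddMeas.mul {f g : ℝ → ℝ} {M N : ℝ} (hf : IsBddMeas f M) (hg : IsBddMeas g N) :
    IsBddMeas (fun x => f x * g x) (M * N) where
  meas := hf.meas.mul hg.meas
  bound x := by
    rw [abs_mul]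
    exact mul_le_mul (hf.bound _) (hg.bound _) (abs_nonneg _) hf.nonneg

lemma IsBddMeas.comp_const_add {f : ℝ → ℝ} {M : ℝ} (hf : IsBddMeas f M) (x : ℝ) :
    IsBddMeas (fun y => f (x + y)) M where
  meas := hf.meas.comp (measurable_const_add x)
  bound _ := hf.bound _

/-- Semigroup law: private variances add inside each factor, common variances add in the diagonal
translation of the product `H`. -/
lemma corrHeat_add {u v : ℝ → ℝ} (hu : IsBddMeas u 1) (hv : IsBddMeas v 1) (κ τ κ' τ' : ℝ≥0)
    (p : ℝ × ℝ) :
    corrHeat (κ + κ') (τ + τ') u v p =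
      ∫ z, corrHeat κ' τ' (heat τ u) (heat τ v) (p.1 + z, p.2 + z) ∂gaussianReal 0 κ := by
  have hU := heat_isBddMeas hu τ
  have hV := heat_isBddMeas hv τ
  have hU' := heat_isBddMeas hU τ'
  have hV' := heat_isBddMeas hV τ'
  have hH := (hU'.comp_const_add p.1).mul (hV'.comp_const_add p.2)
  set H := fun x => heat τ' (heat τ u) (p.1 + x) * heat τ' (heat τ v) (p.2 + x) with hHdef
  have e1 : corrHeat (κ + κ') (τ + τ') u v p = heat (κ + κ') H 0 := by
    simp only [corrHeat, heat.eq_1 (κ + κ'), hHdef, zero_add, heat_heat hu, heat_heat hv,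
      add_comm τ' τ]
  have e2 : ∀ z, corrHeat κ' τ' (heat τ u) (heat τ v) (p.1 + z, p.2 + z) = heat κ' H (0 + z) := by
    intro z
    simp only [corrHeat, zero_add, add_assoc]
    rfl
  simp only [e2]
  rw [e1, ← heat_heat hH, heat.eq_1 κ]

lemma measurable_corrHeat {u v : ℝ → ℝ} {M N : ℝ} (hu : IsBddMeas u M) (hv : IsBddMeas v N)
    (κ τ : ℝ≥0) : Measurable (corrHeat κ τ u v) := by
  have : StronglyMeasurable (Function.uncurry fun (p : ℝ × ℝ) (z : ℝ) =>
      heat τ u (p.1 + z) * heat τ v (p.2 + z)) :=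
    (((heat_isBddMeas hu τ).meas.comp (by fun_prop)).mul
      ((heat_isBddMeas hv τ).meas.comp (by fun_prop))).stronglyMeasurable
  exact this.integral_prod_right.measurable

lemma abs_corrHeat_le {u v : ℝ → ℝ} (hu : IsBddMeas u 1) (hv : IsBddMeas v 1)
    (κ τ : ℝ≥0) (p : ℝ × ℝ) : |corrHeat κ τ u v p| ≤ 1 := by
  refine abs_integral_le_of_abs_le _ fun z => ?_
  rw [abs_mul]
  exact mul_le_one₀ ((heat_isBddMeas hu τ).bound _) (abs_nonneg _) ((heat_isBddMeas hv τ).bound _)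

/-! ### The replacement argument. -/

/-- One exchange. For each value z of the common noise, `heat τ u` and `heat τ v` are smooth with K
= 2/√τ. The law `ν` and `pairGaussian κ' τ'` share second moments, so their quadratic terms cancel
and two fourth-order remainders are left. -/
lemma abs_integral_corrHeat_sub_le {u v : ℝ → ℝ} (hu : IsBddMeas u 1) (hv : IsBddMeas v 1)
    {κ τ κ' τ' : ℝ≥0} (hτ : τ ≠ 0) {ν : Measure (ℝ × ℝ)} [IsProbabilityMeasure ν] {M : ℝ}
    (hν : IsSymmStep ν (κ' + τ') κ' M) (p : ℝ × ℝ) :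
    |∫ w, corrHeat κ τ u v (p + w) ∂ν - corrHeat (κ + κ') (τ + τ') u v p| ≤
      128 / (τ : ℝ) ^ 2 * (M + 2 * gaussianFourth * ((κ' : ℝ) + τ') ^ 2) := by
  obtain ⟨U, hU0, hU⟩ := exists_isDerivChain_heat hu hτ
  obtain ⟨V, hV0, hV⟩ := exists_isDerivChain_heat hv hτ
  have hUb := heat_isBddMeas hu τ
  have hVb := heat_isBddMeas hv τ
  have hK : 8 * (2 / √(τ : ℝ)) ^ 4 = 128 / (τ : ℝ) ^ 2 := by
    rw [div_pow, show (√(τ : ℝ)) ^ 4 = ((√(τ : ℝ)) ^ 2) ^ 2 by ring, Real.sq_sqrt τ.coe_nonneg]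
    norm_num
    ring
  have hpt : ∀ z : ℝ, |∫ w, heat τ u (p.1 + z + w.1) * heat τ v (p.2 + z + w.2) ∂ν -
      corrHeat κ' τ' (heat τ u) (heat τ v) (p.1 + z, p.2 + z)| ≤
      128 / (τ : ℝ) ^ 2 * (M + 2 * gaussianFourth * ((κ' : ℝ) + τ') ^ 2) := by
    intro z
    rw [← integral_pairGaussian hUb hVb]
    have h1 := hν.abs_integral_sub_le hU hV (p.1 + z) (p.2 + z)
    have h2 := (isSymmStep_pairGaussian κ' τ').abs_integral_sub_le hU hV (p.1 + z) (p.2 + z)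
    rw [hK, hU0, hV0] at h1 h2
    rw [abs_le] at h1 h2 ⊢
    constructor <;> linarith [h1.1, h1.2, h2.1, h2.2]
  have hswap : ∫ w, corrHeat κ τ u v (p + w) ∂ν =
      ∫ z, ∫ w, heat τ u (p.1 + z + w.1) * heat τ v (p.2 + z + w.2) ∂ν ∂gaussianReal 0 κ := by
    simp only [corrHeat]
    rw [integral_integral_swap]
    · simp only [Prod.fst_add, Prod.snd_add, add_right_comm]
    · exact hUb.integrable_mul hVb (X := fun q : (ℝ × ℝ) × ℝ => (p + q.1).1 + q.2)
        (Y := fun q : (ℝ × ℝ) × ℝ => (p + q.1).2 + q.2) (by fun_prop) (by fun_prop)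
  have i1 : Integrable (fun z => ∫ w, heat τ u (p.1 + z + w.1) * heat τ v (p.2 + z + w.2) ∂ν)
      (gaussianReal 0 κ) :=
    (hUb.integrable_mul hVb (P := (gaussianReal 0 κ).prod ν)
      (X := fun q : ℝ × ℝ × ℝ => p.1 + q.1 + q.2.1)
      (Y := fun q : ℝ × ℝ × ℝ => p.2 + q.1 + q.2.2) (by fun_prop) (by fun_prop)).integral_prod_left
  have i2 : Integrable (fun z => corrHeat κ' τ' (heat τ u) (heat τ v) (p.1 + z, p.2 + z))
      (gaussianReal 0 κ) :=
    Integrable.of_bound ((measurable_corrHeat hUb hVb κ' τ').comp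
      (by fun_prop)).aestronglyMeasurable 1
      (.of_forall fun z => abs_corrHeat_le hUb hVb _ _ _)
  rw [hswap, corrHeat_add hu hv, ← integral_sub i1 i2]
  exact abs_integral_le_of_abs_le _ hpt

/-- Averaging over an independent increment with law `ν`. -/
def stepOp (ν : Measure (ℝ × ℝ)) (F : ℝ × ℝ → ℝ) (p : ℝ × ℝ) : ℝ := ∫ w, F (p + w) ∂ν

lemma measurable_stepOp {ν : Measure (ℝ × ℝ)} [SFinite ν] {F : ℝ × ℝ → ℝ} (hF : Measurable F) :
    Measurable (stepOp ν F) := by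
  have : StronglyMeasurable (Function.uncurry fun p w : ℝ × ℝ => F (p + w)) :=
    (hF.comp (measurable_fst.add measurable_snd)).stronglyMeasurable
  exact this.integral_prod_right.measurable

lemma iterate_stepOp_bdd {ν : Measure (ℝ × ℝ)} [IsProbabilityMeasure ν] {F : ℝ × ℝ → ℝ}
    (hF : Measurable F) (hb : ∀ p, |F p| ≤ 1) (k : ℕ) :
    Measurable ((stepOp ν)^[k] F) ∧ ∀ p, |(stepOp ν)^[k] F p| ≤ 1 := by
  induction k with
  | zero => exact ⟨hF, hb⟩
  | succ k ih =>
    rw [Function.iterate_succ_apply']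
    exact ⟨measurable_stepOp ih.1, fun p => abs_integral_le_of_abs_le _ fun w => ih.2 _⟩

/-- Lindeberg's replacement argument for smoothed test functions of a symmetric random walk. -/
lemma lindeberg {u v : ℝ → ℝ} (hu : IsBddMeas u 1) (hv : IsBddMeas v 1)
    {τ κ' τ' : ℝ≥0} (hτ : τ ≠ 0) {ν : Measure (ℝ × ℝ)} [IsProbabilityMeasure ν] {M : ℝ}
    (hν : IsSymmStep ν (κ' + τ') κ' M) (k : ℕ) (p : ℝ × ℝ) :
    |(stepOp ν)^[k] (corrHeat 0 τ u v) p - corrHeat (k * κ') (τ + k * τ') u v p| ≤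
      ∑ j ∈ Finset.range k, 128 / ((τ : ℝ) + j * τ') ^ 2 *
        (M + 2 * gaussianFourth * ((κ' : ℝ) + τ') ^ 2) := by
  induction k generalizing p with
  | zero => simp
  | succ k ih =>
    have hb := iterate_stepOp_bdd (ν := ν) (measurable_corrHeat hu hv 0 τ)
      (abs_corrHeat_le hu hv 0 τ) k
    have hm : Measurable fun w : ℝ × ℝ => p + w := by fun_prop
    have i1 : Integrable (fun w => (stepOp ν)^[k] (corrHeat 0 τ u v) (p + w)) ν :=
      Integrable.of_bound (hb.1.comp hm).aestronglyMeasurable 1 (.of_forall fun w => hb.2 _)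
    have i2 : Integrable (fun w => corrHeat (k * κ') (τ + k * τ') u v (p + w)) ν :=
      Integrable.of_bound ((measurable_corrHeat hu hv _ _).comp hm).aestronglyMeasurable 1
        (.of_forall fun w => abs_corrHeat_le hu hv _ _ _)
    -- Averaging is a contraction, so the errors of the first `k` exchanges pass through the next
    -- step unchanged. That step then meets test functions already smoothed by private variance τ +
    -- kτ'.
    have h1 : |∫ w, (stepOp ν)^[k] (corrHeat 0 τ u v) (p + w) ∂ν -
        ∫ w, corrHeat (k * κ') (τ + k * τ') u v (p + w) ∂ν| ≤
        ∑ j ∈ Finset.range k, 128 / ((τ : ℝ) + j * τ') ^ 2 *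
          (M + 2 * gaussianFourth * ((κ' : ℝ) + τ') ^ 2) := by
      rw [← integral_sub i1 i2]
      exact abs_integral_le_of_abs_le _ fun w => ih _
    have hτk : τ + k * τ' ≠ 0 := by
      exact (lt_of_lt_of_le (pos_iff_ne_zero.2 hτ) le_self_add).ne'
    have h2 := abs_integral_corrHeat_sub_le hu hv (κ := k * κ') hτk hν p
    rw [Finset.sum_range_succ, Function.iterate_succ_apply']
    have e1 : ((k + 1 : ℕ) : ℝ≥0) * κ' = k * κ' + κ' := by push_cast; ring
    have e2 : τ + ((k + 1 : ℕ) : ℝ≥0) * τ' = τ + k * τ' + τ' := by push_cast; ring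
    rw [e1, e2]
    push_cast at h2
    exact (abs_sub_le _ _ _).trans (add_le_add h1 h2)

/-! ### Stability of Gaussian correlations under a change of covariance. -/

lemma corrHeat_zero_left (τ : ℝ≥0) (u v : ℝ → ℝ) (p : ℝ × ℝ) :
    corrHeat 0 τ u v p = heat τ u p.1 * heat τ v p.2 := by
  simp [corrHeat]

lemma abs_heat_sub_heat_le {u : ℝ → ℝ} (hu : IsBddMeas u 1) {τ : ℝ≥0} (hτ : τ ≠ 0) (x y : ℝ) :
    |heat τ u y - heat τ u x| ≤ 2 / √τ * |y - x| := by
  obtain ⟨U, hU0, hU⟩ := exists_isDerivChain_heat hu hτ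
  rw [← hU0]
  simpa using convex_univ.norm_image_sub_le_of_norm_hasDerivWithin_le (C := 2 / √τ)
    (fun s _ => (hU.hasDerivAt 0 (by norm_num) s).hasDerivWithinAt)
    (fun s _ => by simpa using (hU.bddMeas 1 (by norm_num)).bound s)
    (Set.mem_univ x) (Set.mem_univ y)

/-- The left side is a covariance, hence unchanged when f(0) and g(0) are subtracted; each of the
two resulting terms is at most L²d. -/
lemma abs_integral_mul_sub_mul_integral_le {f g : ℝ → ℝ} (hf : IsBddMeas f 1) (hg : IsBddMeas g 1)
    {L : ℝ} (hL : 0 ≤ L) (hfL : ∀ n, |f n - f 0| ≤ L * |n|) (hgL : ∀ n, |g n - g 0| ≤ L * |n|)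
    (d : ℝ≥0) :
    |∫ n, f n * g n ∂gaussianReal 0 d - (∫ n, f n ∂gaussianReal 0 d) * ∫ n, g n ∂gaussianReal 0 d| ≤
      2 * L ^ 2 * d := by
  have i1 : Integrable (fun n => f n) (gaussianReal 0 d) := hf.integrable_comp measurable_id
  have i2 : Integrable (fun n => g n) (gaussianReal 0 d) := hg.integrable_comp measurable_id
  have i3 : Integrable (fun n => f n * g n) (gaussianReal 0 d) :=
    hf.integrable_mul hg measurable_id measurable_id
  have iabs : Integrable (fun n : ℝ => |n|) (gaussianReal 0 d) := by
    simpa using (integrable_pow_gaussianReal d 1).abs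
  have e : ∫ n, f n * g n ∂gaussianReal 0 d -
      (∫ n, f n ∂gaussianReal 0 d) * ∫ n, g n ∂gaussianReal 0 d =
      ∫ n, (f n - f 0) * (g n - g 0) ∂gaussianReal 0 d -
        (∫ n, (f n - f 0) ∂gaussianReal 0 d) * ∫ n, (g n - g 0) ∂gaussianReal 0 d := by
    have e1 : ∫ n, (f n - f 0) * (g n - g 0) ∂gaussianReal 0 d =
        ∫ n, f n * g n ∂gaussianReal 0 d - g 0 * ∫ n, f n ∂gaussianReal 0 d -
          f 0 * (∫ n, g n ∂gaussianReal 0 d) + f 0 * g 0 := by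
      have : ∀ n, (f n - f 0) * (g n - g 0) = f n * g n - g 0 * f n - f 0 * g n + f 0 * g 0 :=
        fun n => by ring
      simp only [this]
      have j1 : Integrable (fun n => f n * g n - g 0 * f n) (gaussianReal 0 d) :=
        i3.sub (i1.const_mul _)
      have j2 : Integrable (fun n => f n * g n - g 0 * f n - f 0 * g n) (gaussianReal 0 d) :=
        j1.sub (i2.const_mul _)
      rw [integral_add j2 (integrable_const _), integral_sub j1 (i2.const_mul _),
        integral_sub i3 (i1.const_mul _), integral_const_mul, integral_const_mul]
      simp
    rw [e1, integral_sub i1 (integrable_const _), integral_sub i2 (integrable_const _)]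
    simp
    ring
  have b1 : |∫ n, (f n - f 0) * (g n - g 0) ∂gaussianReal 0 d| ≤ L ^ 2 * d := by
    rw [← integral_sq_gaussianReal d, ← integral_const_mul]
    refine abs_integral_le_integral_abs.trans (integral_mono_of_nonneg
      (.of_forall fun _ => abs_nonneg _) ((integrable_pow_gaussianReal d 2).const_mul _)
      (.of_forall fun n => ?_))
    simp only [abs_mul]
    calc |f n - f 0| * |g n - g 0| ≤ (L * |n|) * (L * |n|) :=
          mul_le_mul (hfL n) (hgL n) (abs_nonneg _) (by positivity)
      _ = L ^ 2 * n ^ 2 := by rw [← sq_abs n]; ring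
  have b2 : ∀ {k : ℝ → ℝ}, (∀ n, |k n - k 0| ≤ L * |n|) →
      |∫ n, (k n - k 0) ∂gaussianReal 0 d| ≤ L * √d := by
    intro k hk
    refine (abs_integral_le_integral_abs.trans (integral_mono_of_nonneg
      (.of_forall fun _ => abs_nonneg _) (iabs.const_mul L) (.of_forall hk))).trans ?_
    rw [integral_const_mul]
    exact mul_le_mul_of_nonneg_left (integral_abs_gaussianReal_le d) hL
  rw [e]
  refine (abs_sub _ _).trans ?_
  rw [abs_mul]
  have b3 := mul_le_mul (b2 hfL) (b2 hgL) (abs_nonneg _) (by positivity)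
  have : L * √d * (L * √d) = L ^ 2 * d := by
    rw [show L * √d * (L * √d) = L ^ 2 * (√d) ^ 2 by ring, Real.sq_sqrt d.coe_nonneg]
  linarith

/-- Moving a variance `d` from the common part to the private parts changes the correlation of
bounded functions by at most `8 d / τ`. -/
lemma abs_corrHeat_sub_corrHeat_le {u v : ℝ → ℝ} (hu : IsBddMeas u 1) (hv : IsBddMeas v 1)
    {τ : ℝ≥0} (hτ : τ ≠ 0) (κ d : ℝ≥0) :
    |corrHeat κ (τ + d) u v 0 - corrHeat (κ + d) τ u v 0| ≤ 8 * d / τ := by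
  have hU := heat_isBddMeas hu τ
  have hV := heat_isBddMeas hv τ
  -- Both sides condition on common noise z of variance κ. The extra noise of variance `d` is shared
  -- here and independent in `e2`, so the difference is a covariance.
  have e1 : corrHeat (κ + d) τ u v 0 = ∫ z, ∫ n, heat τ u (z + n) * heat τ v (z + n)
      ∂gaussianReal 0 d ∂gaussianReal 0 κ := by
    have := corrHeat_add hu hv κ τ d 0 0
    rw [add_zero] at this
    rw [this]
    simp only [corrHeat, heat_zero, Prod.fst_zero, Prod.snd_zero, zero_add]
  have e2 : corrHeat κ (τ + d) u v 0 = ∫ z, (∫ n, heat τ u (z + n) ∂gaussianReal 0 d) *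
      (∫ n, heat τ v (z + n) ∂gaussianReal 0 d) ∂gaussianReal 0 κ := by
    rw [add_comm τ d]
    simp only [corrHeat, ← heat_heat hu, ← heat_heat hv, Prod.fst_zero, Prod.snd_zero, zero_add]
    rfl
  have i1 : Integrable (fun z => ∫ n, heat τ u (z + n) * heat τ v (z + n) ∂gaussianReal 0 d)
      (gaussianReal 0 κ) :=
    (hU.integrable_mul hV (P := (gaussianReal 0 κ).prod (gaussianReal 0 d))
      (X := fun q : ℝ × ℝ => q.1 + q.2) (Y := fun q : ℝ × ℝ => q.1 + q.2)
      (by fun_prop) (by fun_prop)).integral_prod_left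
  have i2 : Integrable (fun z => (∫ n, heat τ u (z + n) ∂gaussianReal 0 d) *
      (∫ n, heat τ v (z + n) ∂gaussianReal 0 d)) (gaussianReal 0 κ) :=
    (heat_isBddMeas hU d).integrable_mul (heat_isBddMeas hV d) measurable_id measurable_id
  rw [e1, e2, abs_sub_comm, ← integral_sub i1 i2]
  refine abs_integral_le_of_abs_le _ fun z => ?_
  have hL : ∀ {w : ℝ → ℝ}, IsBddMeas w 1 → ∀ n, |heat τ w (z + n) - heat τ w (z + 0)| ≤
      2 / √τ * |n| := fun hw n => by
    simpa using abs_heat_sub_heat_le hw hτ (z + 0) (z + n)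
  refine (abs_integral_mul_sub_mul_integral_le (hU.comp_const_add z) (hV.comp_const_add z)
    (L := 2 / √τ) (by positivity) (hL hu) (hL hv) d).trans_eq ?_
  rw [div_pow, Real.sq_sqrt τ.coe_nonneg]
  ring

/-- The sign function with threshold `b`. -/
def threshold (b r : ℝ) : ℝ := if b ≤ r then 1 else -1

lemma threshold_isBddMeas (b : ℝ) : IsBddMeas (threshold b) 1 where
  meas := Measurable.ite measurableSet_Ici measurable_const measurable_const
  bound x := by unfold threshold; split_ifs <;> simp

lemma gaussianReal_Icc_le (b η : ℝ) (hη : 0 ≤ η) :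
    (gaussianReal 0 1).real (Set.Icc (b - η) (b + η)) ≤ 2 * η := by
  rw [measureReal_def, gaussianReal_apply_eq_integral _ one_ne_zero,
    ENNReal.toReal_ofReal (integral_nonneg fun x => gaussianPDFReal_nonneg _ _ _)]
  have h1 : ∀ x, gaussianPDFReal 0 1 x ≤ 1 := by
    intro x
    rw [gaussianPDFReal]
    refine mul_le_one₀ (inv_le_one_of_one_le₀ ?_) (Real.exp_pos _).le ?_
    · rw [Real.one_le_sqrt]
      push_cast
      nlinarith [Real.pi_gt_three]
    · apply Real.exp_le_one_iff.2
      have : 0 ≤ (x - 0) ^ 2 / (2 * ((1 : ℝ≥0) : ℝ)) := by positivity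
      rw [neg_div]; linarith
  calc ∫ x in Set.Icc (b - η) (b + η), gaussianPDFReal 0 1 x
      ≤ ∫ _ in Set.Icc (b - η) (b + η), (1 : ℝ) :=
        setIntegral_mono (integrable_gaussianPDFReal _ _).integrableOn
          (integrableOn_const (by simp)) h1
    _ = 2 * η := by
        simp [measureReal_def, Real.volume_Icc]
        rw [ENNReal.toReal_ofReal (by linarith)]; ring

/-- The signs differ only if s is within η of the threshold or |s - t| ≥ η; the second event is
charged to (s - t)²/η², as in Chebyshev's inequality. -/
lemma abs_threshold_sub_le (b : ℝ) {η : ℝ} (hη : 0 < η) (s t : ℝ) :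
    |threshold b s - threshold b t| ≤
      2 * (Set.Icc (b - η) (b + η)).indicator 1 s + 2 / η ^ 2 * (s - t) ^ 2 := by
  have hle : |threshold b s - threshold b t| ≤ 2 := by
    unfold threshold; split_ifs <;> norm_num
  have hsq : 0 ≤ 2 / η ^ 2 * (s - t) ^ 2 := by positivity
  by_cases hs : s ∈ Set.Icc (b - η) (b + η)
  · rw [Set.indicator_of_mem hs]; simp only [Pi.one_apply]; linarith
  · rw [Set.indicator_of_notMem hs, mul_zero, zero_add]
    by_cases hst : η ≤ |s - t|
    · have h1 : η ^ 2 ≤ (s - t) ^ 2 := by rw [← sq_abs (s - t)]; gcongr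
      have h2 : 2 ≤ 2 / η ^ 2 * (s - t) ^ 2 := by
        rw [div_mul_eq_mul_div, le_div_iff₀ (by positivity)]; linarith
      linarith
    · have hst' := abs_lt.1 (not_le.1 hst)
      have : threshold b s = threshold b t := by
        unfold threshold
        rw [Set.mem_Icc, not_and_or, not_le, not_le] at hs
        rcases hs with h | h
        · rw [if_neg (by linarith), if_neg (by linarith)]
        · rw [if_pos (by linarith), if_pos (by linarith)]
      rw [this, sub_self, abs_zero]; exact hsq

/-- The second coordinate is replaced by the first. The mean square distance is 2τ, and a standard
Gaussian lies within η of the threshold with probability at most 2η. -/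
lemma abs_corrHeat_threshold_sub_le (a b : ℝ) {η : ℝ} (hη : 0 < η) {κ τ : ℝ≥0} (h : κ + τ = 1) :
    |corrHeat κ τ (threshold a) (threshold b) 0 - corrHeat 1 0 (threshold a) (threshold b) 0| ≤
      4 * η + 4 * τ / η ^ 2 := by
  have hu := threshold_isBddMeas a
  have hv := threshold_isBddMeas b
  have h1 : (pairGaussian κ τ).map Prod.fst = gaussianReal 0 1 := by rw [map_fst_pairGaussian, h]
  have e0 := integral_pairGaussian hu hv κ τ 0 0
  simp only [zero_add] at e0
  have e1 : corrHeat 1 0 (threshold a) (threshold b) 0 =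
      ∫ w, threshold a w.1 * threshold b w.1 ∂pairGaussian κ τ := by
    have : ∫ x, threshold a x * threshold b x ∂(pairGaussian κ τ).map Prod.fst =
      ∫ w, threshold a w.1 * threshold b w.1 ∂pairGaussian κ τ :=
      integral_map (by fun_prop) (hu.meas.mul hv.meas).aestronglyMeasurable
    rw [← this, h1]
    simp [corrHeat, heat_zero]
  have hS := isSymmStep_pairGaussian κ τ
  have m1 := hS.memLp_fst.mono_exponent (p := 2) (by norm_num)
  have m2 := hS.memLp_snd.mono_exponent (p := 2) (by norm_num)
  have j1 : Integrable (fun z : ℝ × ℝ => z.1 ^ 2) (pairGaussian κ τ) := m1.integrable_sq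
  have j2 : Integrable (fun z : ℝ × ℝ => z.2 ^ 2) (pairGaussian κ τ) := m2.integrable_sq
  have j3 : Integrable (fun z : ℝ × ℝ => z.1 * z.2) (pairGaussian κ τ) := m1.integrable_mul m2
  have hsqe : ∀ z : ℝ × ℝ, (z.1 - z.2) ^ 2 = z.1 ^ 2 + z.2 ^ 2 - 2 * (z.1 * z.2) := fun z => by ring
  have j12 : Integrable (fun z : ℝ × ℝ => z.1 ^ 2 + z.2 ^ 2) (pairGaussian κ τ) := j1.add j2
  have jsq : Integrable (fun z : ℝ × ℝ => (z.1 - z.2) ^ 2) (pairGaussian κ τ) := by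
    simp only [hsqe]
    exact j12.sub (j3.const_mul 2)
  have esq : ∫ z, (z.1 - z.2) ^ 2 ∂pairGaussian κ τ = 2 * τ := by
    simp only [hsqe]
    rw [integral_sub j12 (j3.const_mul 2), integral_add j1 j2, integral_const_mul, hS.sq_fst,
      hS.sq_snd, hS.mul]
    ring
  have jind : Integrable (fun z : ℝ × ℝ => (Set.Icc (b - η) (b + η)).indicator (1 : ℝ → ℝ) z.1)
      (pairGaussian κ τ) := by
    refine Integrable.of_bound ((measurable_one.indicator measurableSet_Icc).comp
      measurable_fst).aestronglyMeasurable 1 (.of_forall fun z => ?_)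
    unfold Set.indicator; split_ifs <;> simp
  have eind : ∫ z, (Set.Icc (b - η) (b + η)).indicator (1 : ℝ → ℝ) z.1 ∂pairGaussian κ τ ≤ 2 * η := by
    have : ∫ x, (Set.Icc (b - η) (b + η)).indicator (1 : ℝ → ℝ) x ∂(pairGaussian κ τ).map Prod.fst =
        ∫ z, (Set.Icc (b - η) (b + η)).indicator (1 : ℝ → ℝ) z.1 ∂pairGaussian κ τ :=
      integral_map (by fun_prop)
        (measurable_one.indicator measurableSet_Icc).aestronglyMeasurable
    rw [← this, h1, integral_indicator_one measurableSet_Icc]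
    exact gaussianReal_Icc_le b η hη.le
  have i1 : Integrable (fun w : ℝ × ℝ => threshold a w.1 * threshold b w.2) (pairGaussian κ τ) :=
    hu.integrable_mul hv measurable_fst measurable_snd
  have i2 : Integrable (fun w : ℝ × ℝ => threshold a w.1 * threshold b w.1) (pairGaussian κ τ) :=
    hu.integrable_mul hv measurable_fst measurable_fst
  change |corrHeat κ τ _ _ (0, 0) - _| ≤ _
  rw [← e0, e1, abs_sub_comm, ← integral_sub i2 i1]
  calc _ ≤ ∫ w, |threshold a w.1 * threshold b w.1 - threshold a w.1 * threshold b w.2|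
        ∂pairGaussian κ τ := abs_integral_le_integral_abs
    _ ≤ ∫ w, (2 * (Set.Icc (b - η) (b + η)).indicator (1 : ℝ → ℝ) w.1 +
          2 / η ^ 2 * (w.1 - w.2) ^ 2) ∂pairGaussian κ τ := by
        refine integral_mono_of_nonneg (.of_forall fun _ => abs_nonneg _)
          ((jind.const_mul 2).add (jsq.const_mul _)) (.of_forall fun w => ?_)
        simp only [← mul_sub, abs_mul]
        exact (mul_le_of_le_one_left (abs_nonneg _) (hu.bound _)).trans
          (abs_threshold_sub_le b hη _ _)
    _ ≤ 4 * η + 4 * τ / η ^ 2 := by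
        rw [integral_add (jind.const_mul 2) (jsq.const_mul _), integral_const_mul,
          integral_const_mul, esq]
        have : 2 / η ^ 2 * (2 * (τ : ℝ)) = 4 * τ / η ^ 2 := by ring
        linarith

/-! ### Identification with the bivariate Gaussian law. -/

lemma measurable_toLp_pair :
    Measurable fun w : ℝ × ℝ => (!₂[w.1, w.2] : EuclideanSpace ℝ (Fin 2)) := by
  refine (WithLp.measurable_toLp 2 _).comp (measurable_pi_iff.2 fun i => ?_)
  fin_cases i
  · exact measurable_fst
  · exact measurable_snd

open Complex in
-- Characteristic functions: that of (Z + N, Z + N') at t is the product of those of Z at t₀ + t₁, N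
-- at t₀ and N' at t₁.
lemma corrGaussian_eq_map_pairGaussian {κ τ : ℝ≥0} (h : κ + τ = 1) :
    corrGaussian κ = (pairGaussian κ τ).map fun w => !₂[w.1, w.2] := by
  have hr : (κ : ℝ) + τ = 1 := by exact_mod_cast h
  have hm := measurable_toLp_pair
  have hS : (!![1, (κ : ℝ); (κ : ℝ), 1]).PosSemidef := by
    rw [Matrix.posSemidef_iff_dotProduct_mulVec]
    refine ⟨?_, fun x => ?_⟩
    · ext i j; fin_cases i <;> fin_cases j <;> simp
    · simp [Matrix.mulVec, dotProduct, Fin.sum_univ_two]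
      -- The quadratic form is κ(x₀ + x₁)² + τ(x₀² + x₁²).
      nlinarith [mul_nonneg κ.coe_nonneg (sq_nonneg (x 0 + x 1)),
        mul_nonneg τ.coe_nonneg (add_nonneg (sq_nonneg (x 0)) (sq_nonneg (x 1)))]
  have : IsProbabilityMeasure ((pairGaussian κ τ).map fun w =>
      (!₂[w.1, w.2] : EuclideanSpace ℝ (Fin 2))) := Measure.isProbabilityMeasure_map hm.aemeasurable
  have : IsProbabilityMeasure (corrGaussian κ) := by unfold corrGaussian; infer_instance
  apply Measure.ext_of_charFun
  ext t
  have hc : Continuous fun x : EuclideanSpace ℝ (Fin 2) => cexp (inner ℝ x t * I) := by fun_prop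
  rw [corrGaussian, charFun_multivariateGaussian hS, charFun_apply,
    integral_map hm.aemeasurable hc.aestronglyMeasurable]
  have e : ∀ w : ℝ × ℝ, cexp (inner ℝ (!₂[w.1, w.2] : EuclideanSpace ℝ (Fin 2)) t * I) =
      cexp ((w.1 * t 0 + w.2 * t 1 : ℝ) * I) := fun w => by
    simp [PiLp.inner_apply, Fin.sum_univ_two, mul_comm]
  simp only [e]
  rw [pairGaussian, integral_map (by fun_prop) (by fun_prop)]
  have e2 : ∀ p : ℝ × ℝ × ℝ,
      cexp (((p.1 + p.2.1) * t 0 + (p.1 + p.2.2) * t 1 : ℝ) * I) =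
      cexp ((t 0 + t 1 : ℝ) * p.1 * I) * (cexp ((t 0 : ℝ) * p.2.1 * I) * cexp ((t 1 : ℝ) * p.2.2 * I)) :=
    fun p => by
    rw [← Complex.exp_add, ← Complex.exp_add]; congr 1; push_cast; ring
  simp only [e2]
  rw [integral_prod_mul (fun x : ℝ => cexp ((t 0 + t 1 : ℝ) * x * I))
      (fun q : ℝ × ℝ => cexp ((t 0 : ℝ) * q.1 * I) * cexp ((t 1 : ℝ) * q.2 * I)),
    integral_prod_mul (fun x : ℝ => cexp ((t 0 : ℝ) * x * I))
      (fun x : ℝ => cexp ((t 1 : ℝ) * x * I)),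
    ← charFun_apply_real, ← charFun_apply_real, ← charFun_apply_real, charFun_gaussianReal,
    charFun_gaussianReal, charFun_gaussianReal, ← Complex.exp_add, ← Complex.exp_add]
  congr 1
  have hτ : (τ : ℂ) = 1 - (κ : ℂ) := by
    rw [eq_sub_iff_add_eq, add_comm]; exact_mod_cast hr
  simp [Matrix.mulVec, dotProduct, Fin.sum_univ_two]
  rw [hτ]
  ring

lemma integral_corrGaussian {κ τ : ℝ≥0} (h : κ + τ = 1) {u v : ℝ → ℝ} (hu : IsBddMeas u 1)
    (hv : IsBddMeas v 1) :
    ∫ p, u (p 0) * v (p 1) ∂corrGaussian κ = corrHeat κ τ u v 0 := by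
  have hm := measurable_toLp_pair
  have hF : Measurable fun p : EuclideanSpace ℝ (Fin 2) => u (p 0) * v (p 1) :=
    (hu.meas.comp (by fun_prop)).mul (hv.meas.comp (by fun_prop))
  rw [corrGaussian_eq_map_pairGaussian h, integral_map hm.aemeasurable hF.aestronglyMeasurable]
  have := integral_pairGaussian hu hv κ τ 0 0
  simp only [zero_add] at this
  exact this

/-! ### Random walks on finite probability spaces. -/

section Finite

variable {Ω : Type*} [Finite Ω] [MeasurableSpace Ω] [MeasurableSingletonClass Ω]

lemma map_append_prod_pi {h w : ℕ} (μ : Measure Ω) [IsProbabilityMeasure μ] :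
    ((Measure.pi fun _ : Fin h => μ).prod (Measure.pi fun _ : Fin w => μ)).map
      (fun q => Fin.append q.1 q.2) = Measure.pi fun _ : Fin (h + w) => μ := by
  refine (Measure.pi_eq fun s hs => ?_).symm
  have hpre : (fun q : (Fin h → Ω) × (Fin w → Ω) => Fin.append q.1 q.2) ⁻¹' Set.univ.pi s =
      (Set.univ.pi fun i => s (Fin.castAdd w i)) ×ˢ (Set.univ.pi fun i => s (Fin.natAdd h i)) := by
    ext q
    simp only [Set.mem_preimage, Set.mem_univ_pi, Set.mem_prod]
    constructor
    · intro H
      exact ⟨fun i => by simpa using H (Fin.castAdd w i), fun i => by simpa using H (Fin.natAdd h i)⟩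
    · rintro ⟨H1, H2⟩ i
      refine Fin.addCases (fun i => ?_) (fun i => ?_) i
      · simpa using H1 i
      · simpa using H2 i
  rw [Measure.map_apply Measurable.of_discrete (MeasurableSet.univ_pi hs), hpre, Measure.prod_prod,
    Measure.pi_pi, Measure.pi_pi, Fin.prod_univ_add]

lemma integral_pi_add {h w : ℕ} (μ : Measure Ω) [IsProbabilityMeasure μ]
    (F : (Fin (h + w) → Ω) → ℝ) :
    ∫ z, F z ∂(Measure.pi fun _ : Fin (h + w) => μ) =
      ∫ x, ∫ y, F (Fin.append x y) ∂(Measure.pi fun _ : Fin w => μ)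
        ∂(Measure.pi fun _ : Fin h => μ) := by
  rw [← map_append_prod_pi, integral_map Measurable.of_discrete.aemeasurable
    Measurable.of_discrete.aestronglyMeasurable, integral_prod _ Integrable.of_finite]

/-- The law of the difference of two independent copies of `X`. -/
def stepLaw (μ : Measure Ω) (X : Ω → ℝ × ℝ) : Measure (ℝ × ℝ) :=
  (μ.prod μ).map fun q => X q.1 - X q.2

instance (μ : Measure Ω) [IsProbabilityMeasure μ] (X : Ω → ℝ × ℝ) :
    IsProbabilityMeasure (stepLaw μ X) :=
  Measure.isProbabilityMeasure_map Measurable.of_discrete.aemeasurable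

lemma integral_stepLaw (μ : Measure Ω) [IsProbabilityMeasure μ] (X : Ω → ℝ × ℝ) {F : ℝ × ℝ → ℝ}
    (hF : Measurable F) :
    ∫ w, F w ∂stepLaw μ X = ∫ a, ∫ b, F (X a - X b) ∂μ ∂μ := by
  rw [stepLaw, integral_map Measurable.of_discrete.aemeasurable hF.aestronglyMeasurable,
    integral_prod _ Integrable.of_finite]

/-- The alternating signs pair consecutive samples into differences of independent copies, so 2k
samples make k steps of law `stepLaw μ X`. -/
lemma integral_walk (μ : Measure Ω) [IsProbabilityMeasure μ] (X : Ω → ℝ × ℝ) {F : ℝ × ℝ → ℝ}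
    (hF : Measurable F) (hb : ∀ p, |F p| ≤ 1) (k : ℕ) (p : ℝ × ℝ) :
    ∫ z, F (p + ∑ i : Fin (2 * k), (-1 : ℝ) ^ (i : ℕ) • X (z i))
        ∂(Measure.pi fun _ : Fin (2 * k) => μ) = (stepOp (stepLaw μ X))^[k] F p := by
  have hcons : ∀ (n : ℕ) (G : (Fin (n + 1) → Ω) → ℝ),
      ∫ z, G z ∂(Measure.pi fun _ : Fin (n + 1) => μ) =
        ∫ a, ∫ z, G (Fin.cons a z) ∂(Measure.pi fun _ : Fin n => μ) ∂μ := by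
    intro n G
    have := (measurePreserving_piFinSuccAbove (fun _ : Fin (n + 1) => μ) 0).symm.integral_comp' G
    rw [← this, integral_prod _ Integrable.of_finite]
    simp only [MeasurableEquiv.piFinSuccAbove_symm_apply, Fin.insertNthEquiv_zero, Fin.consEquiv]
    rfl
  induction k generalizing p with
  | zero => simp
  | succ k ih =>
    rw [Function.iterate_succ_apply', stepOp, integral_stepLaw μ X
      (F := fun w => (stepOp (stepLaw μ X))^[k] F (p + w))
      ((iterate_stepOp_bdd hF hb k).1.comp (measurable_const_add p))]
    change ∫ z : Fin (2 * k + 1 + 1) → Ω, F (p + ∑ i : Fin (2 * k + 1 + 1), (-1 : ℝ) ^ (i : ℕ) • X (z i))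
        ∂(Measure.pi fun _ : Fin (2 * k + 1 + 1) => μ) = _
    rw [hcons]
    congr 1; ext a
    rw [hcons]
    congr 1; ext b
    rw [← ih]
    congr 1; ext z
    congr 1
    rw [Fin.sum_univ_succ, Fin.sum_univ_succ]
    simp [pow_succ, add_assoc, sub_eq_add_neg]

lemma integral_mul_sub_copy (μ : Measure Ω) [IsProbabilityMeasure μ] {a b : Ω → ℝ}
    (ha : ∫ x, a x ∂μ = 0) :
    ∫ x, ∫ y, (a x - a y) * (b x - b y) ∂μ ∂μ = 2 * ∫ x, a x * b x ∂μ := by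
  have h1 : ∀ x, ∫ y, (a x - a y) * (b x - b y) ∂μ =
      a x * b x - a x * (∫ y, b y ∂μ) + ∫ y, a y * b y ∂μ := by
    intro x
    have e : ∀ y, (a x - a y) * (b x - b y) =
        ((a x * b x - a x * b y) - b x * a y) + a y * b y := fun y => by ring
    simp only [e]
    rw [integral_add .of_finite .of_finite, integral_sub .of_finite .of_finite,
      integral_sub .of_finite .of_finite, integral_const_mul (b x), integral_const_mul (a x) b, ha]
    simp
  simp only [h1]
  rw [integral_add .of_finite .of_finite, integral_sub .of_finite .of_finite, integral_mul_const, ha]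
  simp
  ring

lemma integral_pow_four_sub_copy_le (μ : Measure Ω) [IsProbabilityMeasure μ] (a : Ω → ℝ) :
    ∫ x, ∫ y, (a x - a y) ^ 4 ∂μ ∂μ ≤ 16 * ∫ x, a x ^ 4 ∂μ := by
  have h : ∀ x y, (a x - a y) ^ 4 ≤ 8 * a x ^ 4 + 8 * a y ^ 4 := fun x y => by
    nlinarith [sq_nonneg (a x ^ 2 - a y ^ 2), sq_nonneg ((a x + a y) ^ 2), sq_nonneg (a x + a y),
      mul_nonneg (sq_nonneg (a x - a y)) (sq_nonneg (a x + a y)), sq_nonneg (a x ^ 2 + a y ^ 2),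
      sq_nonneg ((a x - a y) ^ 2)]
  calc ∫ x, ∫ y, (a x - a y) ^ 4 ∂μ ∂μ ≤ ∫ x, ∫ y, (8 * a x ^ 4 + 8 * a y ^ 4) ∂μ ∂μ :=
        integral_mono .of_finite .of_finite fun x =>
          integral_mono .of_finite .of_finite fun y => h x y
    _ = 16 * ∫ x, a x ^ 4 ∂μ := by
        have : ∀ x, ∫ y, (8 * a x ^ 4 + 8 * a y ^ 4) ∂μ = 8 * a x ^ 4 + 8 * ∫ y, a y ^ 4 ∂μ :=
          fun x => by
          rw [integral_add .of_finite .of_finite, integral_const_mul 8 fun y => a y ^ 4]; simp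
        simp only [this]
        rw [integral_add .of_finite .of_finite, integral_const_mul]
        simp
        ring

lemma isSymmStep_stepLaw (μ : Measure Ω) [IsProbabilityMeasure μ] {a b : Ω → ℝ} {r M : ℝ} (s : ℝ)
    (ha : ∫ x, a x ∂μ = 0) (hb : ∫ x, b x ∂μ = 0) (ha2 : ∫ x, a x ^ 2 ∂μ = 1)
    (hb2 : ∫ x, b x ^ 2 ∂μ = 1) (hab : ∫ x, a x * b x ∂μ = r) (ha4 : ∫ x, a x ^ 4 ∂μ ≤ M)
    (hb4 : ∫ x, b x ^ 4 ∂μ ≤ M) :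
    IsSymmStep (stepLaw μ fun x => (s * a x, s * b x)) (2 * s ^ 2) (2 * s ^ 2 * r)
      (32 * s ^ 4 * M) := by
  set X : Ω → ℝ × ℝ := fun x => (s * a x, s * b x)
  have hmem : ∀ {g : ℝ × ℝ → ℝ}, Measurable g → MemLp g 4 (stepLaw μ X) := fun hg =>
    (memLp_map_measure_iff hg.aestronglyMeasurable Measurable.of_discrete.aemeasurable).2 .of_discrete
  have hsq : ∀ {c : Ω → ℝ}, ∫ x, c x ∂μ = 0 → ∫ x, c x ^ 2 ∂μ = 1 →
      ∫ x, ∫ y, (s * c x - s * c y) ^ 2 ∂μ ∂μ = 2 * s ^ 2 := by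
    intro c hc hc2
    have e : ∀ x y, (s * c x - s * c y) ^ 2 = s ^ 2 * ((c x - c y) * (c x - c y)) :=
      fun x y => by ring
    simp only [e, integral_const_mul]
    rw [integral_mul_sub_copy μ hc]
    simp only [← sq, hc2]
    ring
  have h4 : ∀ {c : Ω → ℝ}, ∫ x, c x ^ 4 ∂μ ≤ M →
      ∫ x, ∫ y, (s * c x - s * c y) ^ 4 ∂μ ∂μ ≤ 16 * s ^ 4 * M := by
    intro c hc
    have e : ∀ x y, (s * c x - s * c y) ^ 4 = s ^ 4 * (c x - c y) ^ 4 := fun x y => by ring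
    simp only [e, integral_const_mul]
    have := (integral_pow_four_sub_copy_le μ c).trans (mul_le_mul_of_nonneg_left hc (by norm_num))
    calc _ ≤ s ^ 4 * (16 * M) := mul_le_mul_of_nonneg_left this (by positivity)
      _ = _ := by ring
  refine ⟨?_, hmem measurable_fst, hmem measurable_snd, ?_, ?_, ?_, ?_⟩
  -- Exchanging the two copies negates their difference.
  · have : (μ.prod μ).map Prod.swap = μ.prod μ := Measure.prod_swap
    conv_rhs => rw [stepLaw, ← this, Measure.map_map Measurable.of_discrete measurable_swap]
    rw [stepLaw, Measure.map_map measurable_neg Measurable.of_discrete]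
    congr 1
    ext q <;> simp
  · rw [integral_stepLaw μ X (F := fun z => z.1 ^ 2) (by fun_prop)]
    exact hsq ha ha2
  · rw [integral_stepLaw μ X (F := fun z => z.2 ^ 2) (by fun_prop)]
    exact hsq hb hb2
  · rw [integral_stepLaw μ X (F := fun z => z.1 * z.2) (by fun_prop)]
    have e : ∀ x y, (X x - X y).1 * (X x - X y).2 = s ^ 2 * ((a x - a y) * (b x - b y)) :=
      fun x y => by simp [X]; ring
    simp only [e, integral_const_mul]
    rw [integral_mul_sub_copy μ ha, hab]
    ring
  · rw [integral_stepLaw μ X (F := fun z => z.1 ^ 4 + z.2 ^ 4) (by fun_prop)]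
    have e : ∀ x y, (X x - X y).1 ^ 4 + (X x - X y).2 ^ 4 =
      (s * a x - s * a y) ^ 4 + (s * b x - s * b y) ^ 4 := fun x y => rfl
    have e2 : ∀ x, ∫ y, ((s * a x - s * a y) ^ 4 + (s * b x - s * b y) ^ 4) ∂μ =
        ∫ y, (s * a x - s * a y) ^ 4 ∂μ + ∫ y, (s * b x - s * b y) ^ 4 ∂μ :=
      fun x => integral_add .of_finite .of_finite
    simp only [e, e2]
    rw [integral_add .of_finite .of_finite]
    linarith [h4 ha4, h4 hb4]

end Finite

/-! ### Maximal correlation and the smallest atom. -/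

section MaxCorr

variable {A B : Type*} [Fintype A] [Fintype B] [MeasurableSpace A] [MeasurableSingletonClass A]
  [MeasurableSpace B] [MeasurableSingletonClass B] (μ : Measure (A × B)) [IsProbabilityMeasure μ]

lemma integral_fst_eq (f : A → ℝ) : ∫ x, f x ∂μ.fst = ∫ z, f z.1 ∂μ :=
  integral_map measurable_fst.aemeasurable Measurable.of_discrete.aestronglyMeasurable

lemma integral_snd_eq (g : B → ℝ) : ∫ y, g y ∂μ.snd = ∫ z, g z.2 ∂μ :=
  integral_map measurable_snd.aemeasurable Measurable.of_discrete.aestronglyMeasurable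

/-- A pair of normalized functions with correlation `c`, read as functions on the product. -/
structure IsCorrPair (f : A → ℝ) (g : B → ℝ) (c : ℝ) : Prop where
  mean_fst : ∫ z, f z.1 ∂μ = 0
  mean_snd : ∫ z, g z.2 ∂μ = 0
  sq_fst : ∫ z, f z.1 ^ 2 ∂μ = 1
  sq_snd : ∫ z, g z.2 ^ 2 ∂μ = 1
  mul : ∫ z, f z.1 * g z.2 ∂μ = c

lemma maxCorr_eq : maxCorr μ = sSup {c : ℝ | ∃ f g, IsCorrPair μ f g c} := by
  unfold maxCorr
  congr 1
  ext c
  refine exists_congr fun f => exists_congr fun g => ?_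
  have hv1 : ∫ x, f x ∂μ.fst = 0 → Var[f; μ.fst] = ∫ z, f z.1 ^ 2 ∂μ := fun h => by
    rw [variance_of_integral_eq_zero Measurable.of_discrete.aemeasurable h,
      ← integral_fst_eq μ fun x => f x ^ 2]
  have hv2 : ∫ x, g x ∂μ.snd = 0 → Var[g; μ.snd] = ∫ z, g z.2 ^ 2 ∂μ := fun h => by
    rw [variance_of_integral_eq_zero Measurable.of_discrete.aemeasurable h,
      ← integral_snd_eq μ fun x => g x ^ 2]
  constructor
  · rintro ⟨h1, h2, h3, h4, h5⟩
    rw [hv1 h1] at h3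
    rw [hv2 h2] at h4
    rw [integral_fst_eq] at h1
    rw [integral_snd_eq] at h2
    exact ⟨h1, h2, h3, h4, h5.symm⟩
  · rintro ⟨h1, h2, h3, h4, h5⟩
    rw [← integral_fst_eq] at h1
    rw [← integral_snd_eq] at h2
    exact ⟨h1, h2, (hv1 h1).trans h3, (hv2 h2).trans h4, h5.symm⟩

variable {μ}

lemma IsCorrPair.le_one {f : A → ℝ} {g : B → ℝ} {c : ℝ} (h : IsCorrPair μ f g c) : c ≤ 1 := by
  have h1 : ∫ z, f z.1 * g z.2 ∂μ ≤ ∫ z, (f z.1 ^ 2 + g z.2 ^ 2) / 2 ∂μ :=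
    integral_mono .of_finite .of_finite fun z => by
      change f z.1 * g z.2 ≤ (f z.1 ^ 2 + g z.2 ^ 2) / 2
      nlinarith [sq_nonneg (f z.1 - g z.2)]
  rw [integral_div, integral_add .of_finite .of_finite, h.sq_fst, h.sq_snd, h.mul] at h1
  linarith

lemma IsCorrPair.neg {f : A → ℝ} {g : B → ℝ} {c : ℝ} (h : IsCorrPair μ f g c) :
    IsCorrPair μ (fun x => -f x) g (-c) where
  mean_fst := by rw [integral_neg, h.mean_fst, neg_zero]
  mean_snd := h.mean_snd
  sq_fst := by simpa using h.sq_fst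
  sq_snd := h.sq_snd
  mul := by simp only [neg_mul]; rw [integral_neg, h.mul]

variable (μ)

lemma bddAbove_isCorrPair : BddAbove {c : ℝ | ∃ f g, IsCorrPair μ f g c} :=
  ⟨1, by rintro c ⟨f, g, h⟩; exact h.le_one⟩

lemma maxCorr_le_one : maxCorr μ ≤ 1 := by
  rw [maxCorr_eq]
  exact Real.sSup_le (by rintro c ⟨f, g, h⟩; exact h.le_one) zero_le_one

lemma maxCorr_nonneg : 0 ≤ maxCorr μ := by
  rw [maxCorr_eq]
  rcases Set.eq_empty_or_nonempty {c : ℝ | ∃ f g, IsCorrPair μ f g c} with he | ⟨c, f, g, h⟩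
  · rw [he, Real.sSup_empty]
  · have h1 := le_csSup (bddAbove_isCorrPair μ) ⟨f, g, h⟩
    have h2 := le_csSup (bddAbove_isCorrPair μ) ⟨_, g, h.neg⟩
    linarith

/-- A near-maximizer is enough, so attainment of the supremum is not needed. The sign of c matters
because c serves as a variance of common noise. -/
lemma exists_isCorrPair (h : 0 < maxCorr μ) {ε : ℝ} (hε : 0 < ε) :
    ∃ f g c, IsCorrPair μ f g c ∧ 0 ≤ c ∧ maxCorr μ - ε ≤ c ∧ c ≤ maxCorr μ := by
  have hb := bddAbove_isCorrPair μ
  have hne : {c : ℝ | ∃ f g, IsCorrPair μ f g c}.Nonempty := by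
    by_contra hn
    rw [Set.not_nonempty_iff_eq_empty] at hn
    rw [maxCorr_eq, hn, Real.sSup_empty] at h
    exact lt_irrefl _ h
  have hlt : max 0 (maxCorr μ - ε) < sSup {c : ℝ | ∃ f g, IsCorrPair μ f g c} := by
    rw [← maxCorr_eq]; exact max_lt h (by linarith)
  obtain ⟨c, ⟨f, g, hc⟩, hlt'⟩ := exists_lt_of_lt_csSup hne hlt
  refine ⟨f, g, c, hc, (le_max_left _ _).trans hlt'.le, (le_max_right _ _).trans hlt'.le, ?_⟩
  rw [maxCorr_eq]
  exact le_csSup hb ⟨f, g, hc⟩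

lemma minAtom_spec {Ω : Type*} [Fintype Ω] [MeasurableSpace Ω] [MeasurableSingletonClass Ω]
    (P : Measure Ω) [IsProbabilityMeasure P] :
    0 < minAtom P ∧ minAtom P ≤ 1 ∧ ∀ z, P.real {z} = 0 ∨ minAtom P ≤ P.real {z} := by
  set S : Set ℝ := {p : ℝ | 0 < p ∧ ∃ z : Ω, p = P.real {z}} with hS
  have hfin : S.Finite := (Set.finite_range fun z : Ω => P.real {z}).subset (by
    rintro p ⟨_, z, rfl⟩; exact ⟨z, rfl⟩)
  have hne : S.Nonempty := by
    by_contra hn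
    have h0 : ∀ z : Ω, P.real {z} = 0 := fun z => by
      by_contra hz
      exact hn ⟨_, lt_of_le_of_ne measureReal_nonneg (Ne.symm hz), z, rfl⟩
    have h1 : ∫ _ : Ω, (1 : ℝ) ∂P = 1 := by simp
    rw [integral_fintype .of_finite] at h1
    simp [h0] at h1
  have hmem : minAtom P ∈ S := hne.csInf_mem hfin
  obtain ⟨hpos, z0, hz0⟩ := hmem
  refine ⟨hpos, hz0 ▸ measureReal_le_one, fun z => ?_⟩
  rcases eq_or_lt_of_le (measureReal_nonneg (μ := P) (s := {z})) with hz | hz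
  · exact Or.inl hz.symm
  · exact Or.inr (csInf_le hfin.bddBelow ⟨hz, z, rfl⟩)

/-- On each charged atom P{z} a(z)² ≤ 1, hence a² ≤ 1/α there, and one factor a² can be pulled out
of the fourth moment. -/
lemma integral_pow_four_le {Ω : Type*} [Fintype Ω] [MeasurableSpace Ω] [MeasurableSingletonClass Ω]
    (P : Measure Ω) [IsProbabilityMeasure P] {a : Ω → ℝ} (h : ∫ z, a z ^ 2 ∂P = 1) :
    ∫ z, a z ^ 4 ∂P ≤ 1 / minAtom P := by
  obtain ⟨hpos, _, hmin⟩ := minAtom_spec P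
  rw [integral_fintype .of_finite] at h ⊢
  simp only [smul_eq_mul] at h ⊢
  calc ∑ z, P.real {z} * a z ^ 4 ≤ ∑ z, 1 / minAtom P * (P.real {z} * a z ^ 2) := by
        refine Finset.sum_le_sum fun z _ => ?_
        rcases hmin z with hz | hz
        · simp [hz]
        · have h1 : P.real {z} * a z ^ 2 ≤ 1 := by
            rw [← h]
            exact Finset.single_le_sum (f := fun z => P.real {z} * a z ^ 2)
              (fun i _ => mul_nonneg measureReal_nonneg (sq_nonneg _)) (Finset.mem_univ z)
          have h2 : a z ^ 2 ≤ 1 / minAtom P := by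
            rw [le_div_iff₀ hpos]
            nlinarith [sq_nonneg (a z)]
          have h3 : 0 ≤ P.real {z} * a z ^ 2 := by positivity
          nlinarith
    _ = 1 / minAtom P := by rw [← Finset.mul_sum, h, mul_one]

end MaxCorr

/-! ### Summing the replacement errors. -/

/-- The terms with j ≥ 1 are dominated by the telescoping differences of 1/(b(a + jb)). -/
lemma sum_one_div_sq_le {a b : ℝ} (ha : 0 < a) (hb : 0 < b) (m : ℕ) :
    ∑ j ∈ Finset.range m, 1 / (a + j * b) ^ 2 ≤ 1 / a ^ 2 + 1 / (a * b) := by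
  have key : ∀ m : ℕ, ∑ j ∈ Finset.range (m + 1), 1 / (a + j * b) ^ 2 ≤
      1 / a ^ 2 + 1 / (a * b) - 1 / (b * (a + m * b)) := by
    intro m
    induction m with
    | zero => simp [mul_comm]
    | succ m ih =>
      rw [Finset.sum_range_succ]
      have hc : 0 < a + m * b := by positivity
      have hd : 0 < a + (m + 1 : ℕ) * b := by positivity
      have h1 : 1 / (b * (a + m * b)) - 1 / (b * (a + (m + 1 : ℕ) * b)) =
          1 / ((a + m * b) * (a + (m + 1 : ℕ) * b)) := by
        rw [div_sub_div _ _ (by positivity) (by positivity), div_eq_div_iff (by positivity)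
          (by positivity)]
        push_cast; ring
      have h2 : 1 / (a + (m + 1 : ℕ) * b) ^ 2 ≤ 1 / ((a + m * b) * (a + (m + 1 : ℕ) * b)) := by
        rw [sq]
        refine one_div_le_one_div_of_le (by positivity) (mul_le_mul_of_nonneg_right ?_ hd.le)
        push_cast; linarith
      linarith
  calc ∑ j ∈ Finset.range m, 1 / (a + j * b) ^ 2
      ≤ ∑ j ∈ Finset.range (m + 1), 1 / (a + j * b) ^ 2 := by
        rw [Finset.sum_range_succ]
        have : 0 ≤ 1 / (a + m * b) ^ 2 := by positivity
        linarith
    _ ≤ _ := (key m).trans (sub_le_self _ (by positivity))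

lemma sum_one_div_sq_le' {a b : ℝ} (ha : 0 < a) (hb : 0 ≤ b) (m : ℕ) :
    ∑ j ∈ Finset.range m, 1 / (a + j * b) ^ 2 ≤ m / a ^ 2 := by
  calc ∑ j ∈ Finset.range m, 1 / (a + j * b) ^ 2 ≤ ∑ _j ∈ Finset.range m, 1 / a ^ 2 := by
        refine Finset.sum_le_sum fun j _ => one_div_le_one_div_of_le (by positivity) ?_
        have : 0 ≤ (j : ℝ) * b := by positivity
        gcongr; linarith
    _ = m / a ^ 2 := by simp [div_eq_mul_inv]

/-! ### Simulation of thresholded Gaussians by walks. -/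

/-- The alternating walk with increments `s * f (x i)`. -/
def walk {X : Type*} (s : ℝ) (f : X → ℝ) {n : ℕ} (x : Fin n → X) : ℝ :=
  ∑ i : Fin n, (-1 : ℝ) ^ (i : ℕ) * (s * f (x i))

/-- The absolute constant in the bound for the rounding error. -/
def lindebergConst : ℝ := 128 * (8 + 2 * gaussianFourth)

lemma lindebergConst_ge : 1024 ≤ lindebergConst := by
  unfold lindebergConst; linarith [gaussianFourth_nonneg]

section

variable {A B : Type*} [Fintype A] [Fintype B] [MeasurableSpace A] [MeasurableSingletonClass A]
  [MeasurableSpace B] [MeasurableSingletonClass B] {μ : Measure (A × B)} [IsProbabilityMeasure μ]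

/-- The scale makes the 2m samples contribute variance 1 - δ, so with the initial smoothing δ the
total is 1. Each of the m paired steps has variance (1 - δ)/m and covariance c times that. The
factor 1/m² from the fourth moments is absorbed into the squared denominators. -/
lemma abs_integral_walk_sub_le {f : A → ℝ} {g : B → ℝ} {c δ : ℝ≥0} (hfg : IsCorrPair μ f g c)
    (hδ0 : δ ≠ 0) (hδ : δ ≤ 1) (hc : c ≤ 1) {m : ℕ} (hm : m ≠ 0) {u v : ℝ → ℝ}
    (hu : IsBddMeas u 1) (hv : IsBddMeas v 1) :
    |∫ z, heat δ u (walk √((1 - δ) / (2 * m)) f fun i => (z i).1) *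
        heat δ v (walk √((1 - δ) / (2 * m)) g fun i => (z i).2)
        ∂(Measure.pi fun _ : Fin (2 * m) => μ) -
      corrHeat ((1 - δ) * c) (δ + (1 - δ) * (1 - c)) u v 0| ≤
      lindebergConst / minAtom μ *
        ∑ j ∈ Finset.range m, 1 / ((m : ℝ) * δ + j * ((1 - δ) * (1 - c))) ^ 2 := by
  have hm0 : (0 : ℝ) < m := by exact_mod_cast Nat.pos_of_ne_zero hm
  have hδr : (0 : ℝ) ≤ 1 - δ := by exact_mod_cast sub_nonneg.2 (NNReal.coe_le_coe.2 hδ)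
  have hcr : (0 : ℝ) ≤ 1 - c := by exact_mod_cast sub_nonneg.2 (NNReal.coe_le_coe.2 hc)
  obtain ⟨hα, hα1, -⟩ := minAtom_spec μ
  set s := √((1 - δ) / (2 * m) : ℝ) with hs
  have hs2 : s ^ 2 = (1 - δ) / (2 * m) := Real.sq_sqrt (by positivity)
  set κ' : ℝ≥0 := (1 - δ) * c / m with hκ'
  set τ' : ℝ≥0 := (1 - δ) * (1 - c) / m with hτ'
  have hκc : (κ' : ℝ) = (1 - δ) * c / m := by simp [hκ', NNReal.coe_sub hδ]
  have hτc : (τ' : ℝ) = (1 - δ) * (1 - c) / m := by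
    simp [hτ', NNReal.coe_sub hδ, NNReal.coe_sub hc]
  have hsum : (κ' : ℝ) + τ' = (1 - δ) / m := by rw [hκc, hτc]; field_simp; ring
  have hν := isSymmStep_stepLaw μ (a := fun z => f z.1) (b := fun z => g z.2) s hfg.mean_fst
    hfg.mean_snd hfg.sq_fst hfg.sq_snd hfg.mul (integral_pow_four_le μ hfg.sq_fst)
    (integral_pow_four_le μ hfg.sq_snd)
  have e1 : 2 * s ^ 2 = (κ' : ℝ) + τ' := by rw [hs2, hsum]; field_simp
  have e2 : ((κ' : ℝ) + τ') * c = κ' := by rw [hsum, hκc]; ring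
  rw [e1, e2] at hν
  have hL := lindeberg hu hv hδ0 hν m 0
  rw [← integral_walk μ _ (measurable_corrHeat hu hv 0 δ) (abs_corrHeat_le hu hv 0 δ)] at hL
  have hmN : (m : ℝ≥0) ≠ 0 := by exact_mod_cast hm
  rw [hκ', hτ', mul_div_cancel₀ _ hmN, mul_div_cancel₀ _ hmN, ← hτ', ← hκ'] at hL
  have e3 : ∀ z : Fin (2 * m) → A × B, corrHeat 0 δ u v
      (0 + ∑ i : Fin (2 * m), (-1 : ℝ) ^ (i : ℕ) • (s * f (z i).1, s * g (z i).2)) =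
      heat δ u (walk s f fun i => (z i).1) * heat δ v (walk s g fun i => (z i).2) := by
    intro z
    rw [corrHeat_zero_left, zero_add, Prod.fst_sum, Prod.snd_sum]
    rfl
  simp only [e3] at hL
  refine hL.trans ?_
  rw [Finset.mul_sum]
  refine Finset.sum_le_sum fun j _ => ?_
  have hδp : (0 : ℝ) < δ := by exact_mod_cast pos_iff_ne_zero.2 hδ0
  have hM : 32 * s ^ 4 * (1 / minAtom μ) + 2 * gaussianFourth * ((κ' : ℝ) + τ') ^ 2 ≤
      (8 + 2 * gaussianFourth) / minAtom μ / m ^ 2 := by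
    have h1 : (1 - (δ : ℝ)) ^ 2 ≤ 1 := pow_le_one₀ hδr (by linarith)
    have hg := gaussianFourth_nonneg
    rw [hsum, show s ^ 4 = (s ^ 2) ^ 2 by ring, hs2]
    have h2 : 32 * ((1 - (δ : ℝ)) / (2 * m)) ^ 2 * (1 / minAtom μ) +
        2 * gaussianFourth * ((1 - δ) / m) ^ 2 =
        (1 - (δ : ℝ)) ^ 2 * ((8 / minAtom μ + 2 * gaussianFourth) / m ^ 2) := by
      field_simp; ring
    rw [h2, add_div 8 (2 * gaussianFourth) (minAtom μ)]
    have h3 : 2 * gaussianFourth ≤ 2 * gaussianFourth / minAtom μ := by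
      rw [le_div_iff₀ hα]; nlinarith
    calc _ ≤ 1 * ((8 / minAtom μ + 2 * gaussianFourth) / m ^ 2) :=
          mul_le_mul_of_nonneg_right h1 (by positivity)
      _ ≤ _ := by rw [one_mul]; gcongr
  have e4 : (m : ℝ) * δ + j * ((1 - δ) * (1 - c)) = m * (δ + j * τ') := by
    rw [hτc]; field_simp
  have hpos : 0 < (δ : ℝ) + j * τ' := by positivity
  calc _ ≤ 128 / ((δ : ℝ) + j * τ') ^ 2 * ((8 + 2 * gaussianFourth) / minAtom μ / m ^ 2) :=
        mul_le_mul_of_nonneg_left hM (by positivity)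
    _ = _ := by rw [e4, lindebergConst]; field_simp

lemma integral_pi_fst {n : ℕ} (F : (Fin n → A) → ℝ) :
    ∫ x, F x ∂(Measure.pi fun _ : Fin n => μ.fst) =
      ∫ z, F (fun i => (z i).1) ∂(Measure.pi fun _ : Fin n => μ) := by
  have : (Measure.pi fun _ : Fin n => μ).map (fun z i => (z i).1) =
      Measure.pi fun _ : Fin n => μ.fst :=
    Measure.pi_map_pi (μ := fun _ : Fin n => μ) (f := fun _ => Prod.fst)
      fun _ => measurable_fst.aemeasurable
  rw [← this, integral_map Measurable.of_discrete.aemeasurable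
    Measurable.of_discrete.aestronglyMeasurable]

lemma integral_pi_snd {n : ℕ} (F : (Fin n → B) → ℝ) :
    ∫ x, F x ∂(Measure.pi fun _ : Fin n => μ.snd) =
      ∫ z, F (fun i => (z i).2) ∂(Measure.pi fun _ : Fin n => μ) := by
  have : (Measure.pi fun _ : Fin n => μ).map (fun z i => (z i).2) =
      Measure.pi fun _ : Fin n => μ.snd :=
    Measure.pi_map_pi (μ := fun _ : Fin n => μ) (f := fun _ => Prod.snd)
      fun _ => measurable_snd.aemeasurable
  rw [← this, integral_map Measurable.of_discrete.aemeasurable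
    Measurable.of_discrete.aestronglyMeasurable]

lemma corrHeat_swap (κ τ : ℝ≥0) (u v : ℝ → ℝ) : corrHeat κ τ u v 0 = corrHeat κ τ v u 0 := by
  simp only [corrHeat, Prod.fst_zero, Prod.snd_zero, mul_comm]

lemma heat_one (τ : ℝ≥0) : heat τ (fun _ => 1) = fun _ => 1 := by
  ext x; simp [heat]

/-- A mean is a correlation with the constant 1, so the walk estimate for correlations also controls
the two means. -/
lemma corrHeat_one_right {κ τ : ℝ≥0} (h : κ + τ = 1) {u : ℝ → ℝ} (hu : IsBddMeas u 1) :
    corrHeat κ τ u (fun _ => 1) 0 = ∫ r, u r ∂gaussianReal 0 1 := by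
  have := congrFun (heat_heat hu κ τ) 0
  rw [h] at this
  simp only [heat.eq_1 1, heat.eq_1 κ, zero_add] at this
  simp only [corrHeat, heat_one, Prod.fst_zero, zero_add, mul_one]
  exact this

lemma isBddMeas_one : IsBddMeas (fun _ => 1) 1 := ⟨measurable_const, by simp⟩

variable (μ) in
/-- Functions of `w` samples which replace the thresholds of the two parts of a `ρ`-correlated
Gaussian pair, `ρ` being the maximal correlation of `μ`, up to an error `ζ`. -/
structure IsSimulation (w : ℕ) (ζ : ℝ) (Φ : ℝ → (Fin w → A) → ℝ) (Ψ : ℝ → (Fin w → B) → ℝ) :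
    Prop where
  bdd_fst : ∀ a x, |Φ a x| ≤ 1
  bdd_snd : ∀ b y, |Ψ b y| ≤ 1
  mean_fst : ∀ a, |∫ z, Φ a (fun i => (z i).1) ∂(Measure.pi fun _ : Fin w => μ) -
    ∫ r, threshold a r ∂gaussianReal 0 1| ≤ ζ
  mean_snd : ∀ b, |∫ z, Ψ b (fun i => (z i).2) ∂(Measure.pi fun _ : Fin w => μ) -
    ∫ r, threshold b r ∂gaussianReal 0 1| ≤ ζ
  corr : ∀ a b, |∫ z, Φ a (fun i => (z i).1) * Ψ b (fun i => (z i).2)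
      ∂(Measure.pi fun _ : Fin w => μ) -
    ∫ p, threshold a (p 0) * threshold b (p 1) ∂corrGaussian (maxCorr μ)| ≤ ζ

variable (μ) in
/-- The walk-based simulation, given the error bounds for the two terms in the triangle
inequality. -/
lemma exists_isSimulation_walk {f : A → ℝ} {g : B → ℝ} {c δ κ τ : ℝ≥0}
    (hfg : IsCorrPair μ f g c) (hδ0 : δ ≠ 0) (hδ : δ ≤ 1) (hc : c ≤ 1) {m : ℕ} (hm : m ≠ 0)
    (hκ : (κ : ℝ) = maxCorr μ) (hκτ : κ + τ = 1) {ζ : ℝ}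
    (h1 : lindebergConst / minAtom μ *
        ∑ j ∈ Finset.range m, 1 / ((m : ℝ) * δ + j * ((1 - δ) * (1 - c))) ^ 2 ≤ ζ / 2)
    (h2 : ∀ a b, |corrHeat ((1 - δ) * c) (δ + (1 - δ) * (1 - c)) (threshold a) (threshold b) 0 -
      corrHeat κ τ (threshold a) (threshold b) 0| ≤ ζ / 2) :
    ∃ Φ Ψ, IsSimulation μ (2 * m) ζ Φ Ψ := by
  have hζ : 0 ≤ ζ := by linarith [(abs_nonneg _).trans (h2 0 0)]
  have hone : (1 - δ) * c + (δ + (1 - δ) * (1 - c)) = 1 := by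
    apply NNReal.eq
    push_cast [NNReal.coe_sub hδ, NNReal.coe_sub hc]
    ring
  have ht := threshold_isBddMeas
  have hW := fun {u v : ℝ → ℝ} (hu : IsBddMeas u 1) (hv : IsBddMeas v 1) =>
    (abs_integral_walk_sub_le hfg hδ0 hδ hc hm hu hv).trans h1
  refine ⟨fun a x => heat δ (threshold a) (walk √((1 - δ) / (2 * m)) f x),
    fun b y => heat δ (threshold b) (walk √((1 - δ) / (2 * m)) g y),
    fun a x => (heat_isBddMeas (ht a) δ).bound _, fun b y => (heat_isBddMeas (ht b) δ).bound _,
    fun a => ?_, fun b => ?_, fun a b => ?_⟩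
  · have := hW (ht a) isBddMeas_one
    rw [corrHeat_one_right hone (ht a)] at this
    simp only [heat_one, mul_one] at this
    linarith
  · have := hW isBddMeas_one (ht b)
    rw [corrHeat_swap, corrHeat_one_right hone (ht b)] at this
    simp only [heat_one, one_mul] at this
    linarith
  · rw [← hκ, integral_corrGaussian hκτ (ht a) (ht b)]
    refine (abs_sub_le _ _ _).trans ((add_le_add (hW (ht a) (ht b)) (h2 a b)).trans_eq ?_)
    ring

lemma measurable_of_threshold {X : Type*} [Finite X] [MeasurableSpace X]
    [MeasurableSingletonClass X] {k : X × ℝ → ℝ} {K : X → ℝ}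
    (hk : ∀ x r, k (x, r) = threshold (K x) r) : Measurable k := by
  refine measurable_from_prod_countable_right fun x => ?_
  simp only [hk]
  exact (threshold_isBddMeas _).meas

lemma abs_le_one_of_threshold {X : Type*} {k : X × ℝ → ℝ} {K : X → ℝ}
    (hk : ∀ x r, k (x, r) = threshold (K x) r) (q : X × ℝ) : |k q| ≤ 1 := by
  obtain ⟨x, r⟩ := q
  rw [hk]
  exact (threshold_isBddMeas _).bound _

/-- The first `h` samples select the two thresholds and the last `w` replace the Gaussians.
Conditionally on the former each error is at most ζ, hence also on average. -/
lemma IsSimulation.exists_rounding {w : ℕ} {ζ : ℝ} {Φ : ℝ → (Fin w → A) → ℝ}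
    {Ψ : ℝ → (Fin w → B) → ℝ} (H : IsSimulation μ w ζ Φ Ψ) (h : ℕ) (f₂ : (Fin h → A) × ℝ → ℝ)
    (g₂ : (Fin h → B) × ℝ → ℝ) (hf₂ : IsThreshold f₂) (hg₂ : IsThreshold g₂) :
    ∃ (f₃ : (Fin (h + w) → A) → ℝ) (g₃ : (Fin (h + w) → B) → ℝ),
      (∀ x, f₃ x ∈ Set.Icc (-1 : ℝ) 1) ∧ (∀ y, g₃ y ∈ Set.Icc (-1 : ℝ) 1) ∧
      |(∫ x, f₃ x ∂(Measure.pi fun _ : Fin (h + w) => μ.fst)) -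
        ∫ p, f₂ p ∂((Measure.pi fun _ : Fin h => μ.fst).prod (gaussianReal 0 1))| ≤ ζ ∧
      |(∫ y, g₃ y ∂(Measure.pi fun _ : Fin (h + w) => μ.snd)) -
        ∫ p, g₂ p ∂((Measure.pi fun _ : Fin h => μ.snd).prod (gaussianReal 0 1))| ≤ ζ ∧
      |(∫ z, f₃ (fun i => (z i).1) * g₃ (fun i => (z i).2)
          ∂(Measure.pi fun _ : Fin (h + w) => μ)) -
        ∫ p, f₂ (fun i => (p.1 i).1, p.2 0) * g₂ (fun i => (p.1 i).2, p.2 1)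
          ∂((Measure.pi fun _ : Fin h => μ).prod (corrGaussian (maxCorr μ)))| ≤ ζ := by
  obtain ⟨F, hF⟩ := hf₂
  obtain ⟨G, hG⟩ := hg₂
  have hF' : ∀ x r, f₂ (x, r) = threshold (F x) r := hF
  have hG' : ∀ x r, g₂ (x, r) = threshold (G x) r := hG
  have ht := threshold_isBddMeas
  have : IsProbabilityMeasure (corrGaussian (maxCorr μ)) := by unfold corrGaussian; infer_instance
  refine ⟨fun x => Φ (F fun i => x (Fin.castAdd w i)) fun j => x (Fin.natAdd h j),
    fun y => Ψ (G fun i => y (Fin.castAdd w i)) fun j => y (Fin.natAdd h j),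
    fun x => abs_le.1 (H.bdd_fst _ _), fun y => abs_le.1 (H.bdd_snd _ _), ?_, ?_, ?_⟩
  · rw [integral_pi_add, integral_prod _ (Integrable.of_bound
      (measurable_of_threshold hF').aestronglyMeasurable 1
        (.of_forall (abs_le_one_of_threshold hF'))), ← integral_sub .of_finite .of_finite]
    refine abs_integral_le_of_abs_le _ fun x => ?_
    simp only [hF', Fin.append_left, Fin.append_right]
    rw [integral_pi_fst]
    exact H.mean_fst _
  · rw [integral_pi_add, integral_prod _ (Integrable.of_bound
      (measurable_of_threshold hG').aestronglyMeasurable 1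
        (.of_forall (abs_le_one_of_threshold hG'))), ← integral_sub .of_finite .of_finite]
    refine abs_integral_le_of_abs_le _ fun x => ?_
    simp only [hG', Fin.append_left, Fin.append_right]
    rw [integral_pi_snd]
    exact H.mean_snd _
  · have hm : Measurable fun p : (Fin h → A × B) × EuclideanSpace ℝ (Fin 2) =>
        f₂ (fun i => (p.1 i).1, p.2 0) * g₂ (fun i => (p.1 i).2, p.2 1) := by
      refine ((measurable_of_threshold hF').comp ?_).mul ((measurable_of_threshold hG').comp ?_)
      · exact Measurable.prodMk (by fun_prop) (by fun_prop)
      · exact Measurable.prodMk (by fun_prop) (by fun_prop)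
    rw [integral_pi_add, integral_prod _ (Integrable.of_bound hm.aestronglyMeasurable 1
      (.of_forall fun p => ?_)), ← integral_sub .of_finite .of_finite]
    · refine abs_integral_le_of_abs_le _ fun x => ?_
      simp only [hF', hG', Fin.append_left, Fin.append_right]
      exact H.corr _ _
    · rw [Real.norm_eq_abs, abs_mul]
      exact mul_le_one₀ (abs_le_one_of_threshold hF' _) (abs_nonneg _) (abs_le_one_of_threshold hG' _)

/-! ### Choice of parameters according to the maximal correlation. -/

variable (μ) in
lemma isSimulation_of_one_le {ζ : ℝ} (hζ : 1 ≤ ζ) :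
    IsSimulation μ 0 ζ (fun _ _ => 0) (fun _ _ => 0) := by
  have ht := threshold_isBddMeas
  have : IsProbabilityMeasure (corrGaussian (maxCorr μ)) := by unfold corrGaussian; infer_instance
  have hint : ∀ a, |∫ r, threshold a r ∂gaussianReal 0 1| ≤ ζ := fun a =>
    (abs_integral_le_of_abs_le _ (ht a).bound).trans hζ
  refine ⟨by simp, by simp, fun a => by simpa using hint a, fun b => by simpa using hint b,
    fun a b => ?_⟩
  simp only [mul_zero, integral_zero, zero_sub, abs_neg]
  refine (abs_integral_le_of_abs_le _ fun p => ?_).trans hζ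
  rw [abs_mul]
  exact mul_le_one₀ ((ht a).bound _) (abs_nonneg _) ((ht b).bound _)

variable (μ) in
-- Uncorrelated Gaussians are independent, so constants equal to the means are exact. This also
-- covers a point-mass marginal, where no normalized pair exists.
lemma isSimulation_of_maxCorr_eq_zero {ζ : ℝ} (hζ : 0 ≤ ζ) (h0 : maxCorr μ = 0) :
    IsSimulation μ 0 ζ (fun a _ => ∫ r, threshold a r ∂gaussianReal 0 1)
      (fun b _ => ∫ r, threshold b r ∂gaussianReal 0 1) := by
  have ht := threshold_isBddMeas
  have e : ∀ a b, ∫ p, threshold a (p 0) * threshold b (p 1) ∂corrGaussian (maxCorr μ) =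
      (∫ r, threshold a r ∂gaussianReal 0 1) * ∫ r, threshold b r ∂gaussianReal 0 1 := by
    intro a b
    rw [h0, ← NNReal.coe_zero, integral_corrGaussian (zero_add 1) (ht a) (ht b),
      corrHeat_zero_left]
    simp [heat]
  refine ⟨fun a _ => abs_integral_le_of_abs_le _ (ht a).bound,
    fun b _ => abs_integral_le_of_abs_le _ (ht b).bound, fun a => by simpa using hζ,
    fun b => by simpa using hζ, fun a b => ?_⟩
  rw [e]
  simpa using hζ

variable (μ) in
lemma exists_isSimulation_of_maxCorr_lt_one {ζ : ℝ} (hζ : 0 < ζ) (hζ1 : ζ ≤ 1)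
    (h0 : 0 < maxCorr μ) (h1 : maxCorr μ < 1) :
    ∃ w : ℕ, (w : ℝ) ≤ (512 * lindebergConst + 2) *
        ((1 + maxCorr μ) / (minAtom μ * (1 - maxCorr μ) ^ 3 * ζ ^ 2)) ∧
      ∃ Φ Ψ, IsSimulation μ w ζ Φ Ψ := by
  obtain ⟨hα, hα1, -⟩ := minAtom_spec μ
  have hK := lindebergConst_ge
  set ρ := maxCorr μ with hρ
  set α := minAtom μ with hαdef
  set K := lindebergConst with hKdef
  set η := 1 - ρ with hη
  have hη0 : 0 < η := by linarith
  have hη1 : η ≤ 1 := by linarith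
  -- This number is both the smoothing variance δ and the allowed loss ρ - c. Then d = ρ - (1 - δ)c
  -- ≤ 2δ, and 8d/η ≤ ζ/2.
  have hδpos : 0 < ζ * η / 32 := by positivity
  obtain ⟨f, g, c, hfg, hc0, hc1, hc2⟩ := exists_isCorrPair μ h0 hδpos
  rw [← hρ] at hc1 hc2
  have hζη : ζ * η ≤ 1 := mul_le_one₀ hζ1 hη0.le hη1
  -- Chosen so that (K/α) · 2/(mδη) = 64K/(αmζη²) is at most ζ/4.
  set N := 256 * K / (α * ζ ^ 2 * η ^ 2) with hN
  have hD : 0 < α * ζ ^ 2 * η ^ 2 := by positivity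
  have hNpos : 0 < N := by positivity
  have hmN : N ≤ ⌈N⌉₊ := Nat.le_ceil N
  have hm : ⌈N⌉₊ ≠ 0 := (Nat.ceil_pos.2 hNpos).ne'
  have hmlt : (⌈N⌉₊ : ℝ) < N + 1 := Nat.ceil_lt_add_one hNpos.le
  set m := ⌈N⌉₊ with hmdef
  have hm0 : (0 : ℝ) < m := hNpos.trans_le hmN
  have hmD : 256 * K ≤ m * (α * ζ ^ 2 * η ^ 2) := (div_le_iff₀ hD).1 hmN
  refine ⟨2 * m, ?_, ?_⟩
  · have hD1 : α * ζ ^ 2 * η ^ 2 ≤ 1 :=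
      mul_le_one₀ (mul_le_one₀ hα1 (by positivity) (pow_le_one₀ hζ.le hζ1)) (by positivity)
        (pow_le_one₀ hη0.le hη1)
    have h2 : N + 1 ≤ (256 * K + 1) / (α * ζ ^ 2 * η ^ 2) := by
      rw [add_div]
      have : 1 ≤ 1 / (α * ζ ^ 2 * η ^ 2) := (one_le_div hD).2 hD1
      linarith
    -- The construction yields η⁻²; the stated (1 + ρ)η⁻³ is weaker since η ≤ 1 ≤ 1 + ρ.
    have h3 : 1 / (α * ζ ^ 2 * η ^ 2) ≤ (1 + ρ) / (α * η ^ 3 * ζ ^ 2) := by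
      rw [div_le_div_iff₀ hD (by positivity)]
      have : α * η ^ 3 * ζ ^ 2 = (α * ζ ^ 2 * η ^ 2) * η := by ring
      rw [this]
      nlinarith
    push_cast
    calc 2 * (m : ℝ) ≤ 2 * ((256 * K + 1) / (α * ζ ^ 2 * η ^ 2)) := by linarith
      _ = (512 * K + 2) * (1 / (α * ζ ^ 2 * η ^ 2)) := by ring
      _ ≤ _ := mul_le_mul_of_nonneg_left h3 (by positivity)
  · lift c to ℝ≥0 using hc0
    obtain ⟨δ, hδ⟩ : ∃ δ : ℝ≥0, (δ : ℝ) = ζ * η / 32 := ⟨⟨_, hδpos.le⟩, rfl⟩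
    obtain ⟨κ, hκ⟩ : ∃ κ : ℝ≥0, (κ : ℝ) = ρ := ⟨⟨ρ, h0.le⟩, rfl⟩
    obtain ⟨τ, hτ⟩ : ∃ τ : ℝ≥0, (τ : ℝ) = η := ⟨⟨η, hη0.le⟩, rfl⟩
    have hδ1 : δ ≤ 1 := by rw [← NNReal.coe_le_coe, hδ, NNReal.coe_one]; linarith
    have hδ0 : δ ≠ 0 := by rw [← NNReal.coe_ne_zero, hδ]; exact hδpos.ne'
    have hcle : c ≤ 1 := by rw [← NNReal.coe_le_coe, NNReal.coe_one]; linarith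
    have hτ0 : τ ≠ 0 := by rw [← NNReal.coe_ne_zero, hτ]; exact hη0.ne'
    have hκτ : κ + τ = 1 := NNReal.eq (by push_cast; rw [hκ, hτ]; linarith)
    have hδc : ((1 - δ : ℝ≥0) : ℝ) = 1 - δ := by rw [NNReal.coe_sub hδ1, NNReal.coe_one]
    have hcc : ((1 - c : ℝ≥0) : ℝ) = 1 - c := by rw [NNReal.coe_sub hcle, NNReal.coe_one]
    refine exists_isSimulation_walk μ hfg hδ0 hδ1 hcle hm hκ hκτ ?_ fun a b => ?_
    · have hb : η / 2 ≤ (1 - δ) * (1 - c) := by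
        have : 1 / 2 ≤ 1 - (δ : ℝ) := by rw [hδ]; linarith
        have : η ≤ 1 - (c : ℝ) := by linarith
        nlinarith
      have ha : 0 < (m : ℝ) * δ := by rw [hδ]; positivity
      have hb0 : 0 < η / 2 := by positivity
      have hsum := sum_one_div_sq_le ha (hb0.trans_le hb) m
      have hab : 1 / (m * δ * ((1 - δ) * (1 - c))) ≤ 1 / (m * δ * (η / 2) : ℝ) :=
        one_div_le_one_div_of_le (by positivity) (mul_le_mul_of_nonneg_left hb ha.le)
      have hbd1 : K / α * (1 / (m * δ * (η / 2))) ≤ ζ / 4 := by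
        rw [hδ, div_mul_div_comm, mul_one, div_le_div_iff₀ (by positivity) (by norm_num)]
        have : ζ * (α * (m * (ζ * η / 32) * (η / 2))) = m * (α * ζ ^ 2 * η ^ 2) / 64 := by ring
        rw [this]; linarith
      have hbd2 : K / α * (1 / (m * δ) ^ 2) ≤ ζ / 4 := by
        rw [hδ, div_mul_div_comm, mul_one, div_le_div_iff₀ (by positivity) (by norm_num)]
        have e : ζ * (α * (m * (ζ * η / 32)) ^ 2) =
          (m * (α * ζ ^ 2 * η ^ 2)) * (m * ζ) / 1024 := by ring
        have hmζ : 256 * K ≤ m * ζ := by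
          refine hmD.trans (mul_le_mul_of_nonneg_left ?_ hm0.le)
          have h5 : α * ζ * η ^ 2 ≤ 1 :=
            mul_le_one₀ (mul_le_one₀ hα1 hζ.le hζ1) (by positivity) (pow_le_one₀ hη0.le hη1)
          calc α * ζ ^ 2 * η ^ 2 = α * ζ * η ^ 2 * ζ := by ring
            _ ≤ 1 * ζ := mul_le_mul_of_nonneg_right h5 hζ.le
            _ = ζ := one_mul ζ
        -- The isolated 1/(mδ)² is quadratic in m, so two lower bounds on m are multiplied.
        have h6 : 256 * K * (256 * K) ≤ (m * (α * ζ ^ 2 * η ^ 2)) * (m * ζ) :=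
          mul_le_mul hmD hmζ (by positivity) (by positivity)
        have h7 : 4096 * K ≤ 256 * K * (256 * K) := by
          have : 0 ≤ K * (K - 1) := mul_nonneg (by linarith) (by linarith)
          linarith
        rw [e]
        linarith
      calc _ ≤ K / α * (1 / (m * δ) ^ 2 + 1 / (m * δ * (η / 2))) :=
            mul_le_mul_of_nonneg_left (hsum.trans (by linarith)) (by positivity)
        _ ≤ ζ / 2 := by rw [mul_add]; linarith
    · have hd : (1 - (δ : ℝ)) * c ≤ κ := by
        rw [hκ]; nlinarith [δ.coe_nonneg, c.coe_nonneg]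
      obtain ⟨d, hd'⟩ : ∃ d : ℝ≥0, (d : ℝ) = κ - (1 - δ) * c := ⟨⟨_, sub_nonneg.2 hd⟩, rfl⟩
      have e1 : κ = (1 - δ) * c + d := NNReal.eq (by push_cast; rw [hδc, hd']; ring)
      have e2 : δ + (1 - δ) * (1 - c) = τ + d := NNReal.eq (by
        push_cast; rw [hδc, hcc, hd', hτ, hκ]; ring)
      rw [e2, e1]
      refine (abs_corrHeat_sub_corrHeat_le (threshold_isBddMeas a) (threshold_isBddMeas b) hτ0
        _ d).trans ?_
      rw [hτ, div_le_iff₀ hη0]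
      have : (d : ℝ) ≤ 2 * δ := by
        rw [hd', hκ]
        have : (c : ℝ) ≤ 1 := by exact_mod_cast hcle
        nlinarith [δ.coe_nonneg]
      rw [hδ] at this
      linarith

variable (μ) in
lemma exists_isSimulation_of_maxCorr_eq_one {ζ : ℝ} (hζ : 0 < ζ) (hζ1 : ζ ≤ 1)
    (h1 : maxCorr μ = 1) : ∃ w : ℕ, ∃ Φ Ψ, IsSimulation μ w ζ Φ Ψ := by
  obtain ⟨hα, hα1, -⟩ := minAtom_spec μ
  have hK : 0 < lindebergConst := by linarith [lindebergConst_ge]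
  -- With threshold window η = ζ/16 and private variance at most 2δ, both 4η and 4 · 2δ/η² are at
  -- most ζ/4.
  have hδpos : 0 < ζ ^ 3 / 8192 := by positivity
  obtain ⟨f, g, c, hfg, hc0, hc1, hc2⟩ := exists_isCorrPair μ (by rw [h1]; norm_num) hδpos
  rw [h1] at hc1 hc2
  lift c to ℝ≥0 using hc0
  obtain ⟨δ, hδ⟩ : ∃ δ : ℝ≥0, (δ : ℝ) = ζ ^ 3 / 8192 := ⟨⟨_, hδpos.le⟩, rfl⟩
  have hδp : (0 : ℝ) < δ := by rw [hδ]; exact hδpos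
  have hδ1 : δ ≤ 1 := by
    rw [← NNReal.coe_le_coe, hδ, NNReal.coe_one]
    linarith [pow_le_one₀ (n := 3) hζ.le hζ1]
  have hδ0 : δ ≠ 0 := by rw [← NNReal.coe_ne_zero, hδ]; exact hδpos.ne'
  have hcle : c ≤ 1 := by rw [← NNReal.coe_le_coe, NNReal.coe_one]; linarith
  have hδc : ((1 - δ : ℝ≥0) : ℝ) = 1 - δ := by rw [NNReal.coe_sub hδ1, NNReal.coe_one]
  have hcc : ((1 - c : ℝ≥0) : ℝ) = 1 - c := by rw [NNReal.coe_sub hcle, NNReal.coe_one]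
  have hδr : (δ : ℝ) ≤ 1 := by exact_mod_cast hδ1
  have hcr : (c : ℝ) ≤ 1 := by exact_mod_cast hcle
  set N := 2 * lindebergConst / (minAtom μ * δ ^ 2 * ζ) with hN
  have hNpos : 0 < N := by positivity
  have hmN : N ≤ ⌈N⌉₊ := Nat.le_ceil N
  have hm0 : (0 : ℝ) < ⌈N⌉₊ := hNpos.trans_le hmN
  have hm : ⌈N⌉₊ ≠ 0 := (Nat.ceil_pos.2 hNpos).ne'
  set m := ⌈N⌉₊ with hmdef
  have hmD : 2 * lindebergConst ≤ m * (minAtom μ * δ ^ 2 * ζ) :=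
    (div_le_iff₀ (by positivity)).1 hmN
  refine ⟨2 * m, exists_isSimulation_walk μ (κ := 1) (τ := 0) hfg hδ0 hδ1 hcle hm (by simp [h1])
    (by simp) ?_ fun a b => ?_⟩
  -- Here c may equal 1, so the private noise need not grow; every term is bounded by 1/(mδ)², and
  -- the choice of m makes K/(αmδ²) ≤ ζ/2.
  · have hsum := sum_one_div_sq_le' (b := (1 - (δ : ℝ)) * (1 - c)) (mul_pos hm0 hδp)
      (mul_nonneg (by linarith) (by linarith)) m
    refine (mul_le_mul_of_nonneg_left hsum (by positivity)).trans ?_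
    rw [div_mul_div_comm, div_le_div_iff₀ (by positivity) (by norm_num)]
    nlinarith
  · have hone : (1 - δ) * c + (δ + (1 - δ) * (1 - c)) = 1 := by
      apply NNReal.eq
      push_cast [hδc, hcc]
      ring
    have hη : 0 < ζ / 16 := by positivity
    refine (abs_corrHeat_threshold_sub_le a b hη hone).trans ?_
    have hτ : ((δ + (1 - δ) * (1 - c) : ℝ≥0) : ℝ) ≤ 2 * (ζ ^ 3 / 8192) := by
      push_cast
      rw [hδc, hcc, ← hδ]
      rw [← hδ] at hc1
      nlinarith
    have : 4 * ((δ + (1 - δ) * (1 - c) : ℝ≥0) : ℝ) / (ζ / 16) ^ 2 ≤ ζ / 4 := by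
      rw [div_le_iff₀ (by positivity)]
      have : ζ / 4 * (ζ / 16) ^ 2 = 8 * (ζ ^ 3 / 8192) := by ring
      rw [this]; linarith
    linarith

end

end WitsenhausenRounding

end

/-! ### The main theorem. -/

theorem mainTheorem6 :
    ∃ C : ℝ, 0 < C ∧
      ∀ (A B : Type*) [Fintype A] [Fintype B]
        [MeasurableSpace A] [MeasurableSingletonClass A]
        [MeasurableSpace B] [MeasurableSingletonClass B]
        (μ : Measure (A × B)) [IsProbabilityMeasure μ] (ζ : ℝ), 0 < ζ →
      ∃ w : ℕ,
        (WitsenhausenRounding.maxCorr μ < 1 →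
          (w : ℝ) ≤ C * ((1 + WitsenhausenRounding.maxCorr μ) /
            (WitsenhausenRounding.minAtom μ *
              (1 - WitsenhausenRounding.maxCorr μ) ^ 3 * ζ ^ 2))) ∧
        ∀ (h : ℕ) (f₂ : (Fin h → A) × ℝ → ℝ) (g₂ : (Fin h → B) × ℝ → ℝ),
          WitsenhausenRounding.IsThreshold f₂ → WitsenhausenRounding.IsThreshold g₂ →
          ∃ (f₃ : (Fin (h + w) → A) → ℝ) (g₃ : (Fin (h + w) → B) → ℝ),
            (∀ x, f₃ x ∈ Set.Icc (-1 : ℝ) 1) ∧ (∀ y, g₃ y ∈ Set.Icc (-1 : ℝ) 1) ∧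
            |(∫ x, f₃ x ∂(Measure.pi fun _ : Fin (h + w) => μ.fst)) -
              ∫ p, f₂ p ∂((Measure.pi fun _ : Fin h => μ.fst).prod (gaussianReal 0 1))| ≤ ζ ∧
            |(∫ y, g₃ y ∂(Measure.pi fun _ : Fin (h + w) => μ.snd)) -
              ∫ p, g₂ p ∂((Measure.pi fun _ : Fin h => μ.snd).prod (gaussianReal 0 1))| ≤ ζ ∧
            |(∫ z, f₃ (fun i => (z i).1) * g₃ (fun i => (z i).2)
                ∂(Measure.pi fun _ : Fin (h + w) => μ)) -
              ∫ p, f₂ (fun i => (p.1 i).1, p.2 0) * g₂ (fun i => (p.1 i).2, p.2 1)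
                ∂((Measure.pi fun _ : Fin h => μ).prod
                  (WitsenhausenRounding.corrGaussian (WitsenhausenRounding.maxCorr μ)))| ≤ ζ := by
  open WitsenhausenRounding in
  have hK := lindebergConst_ge
  refine ⟨512 * lindebergConst + 2, by linarith, ?_⟩
  intro A B _ _ _ _ _ _ μ _ ζ hζ
  -- The simulation does not involve the number of initial samples, so one `w` serves all of them.
  suffices h : ∃ w : ℕ, (maxCorr μ < 1 → (w : ℝ) ≤ (512 * lindebergConst + 2) *
      ((1 + maxCorr μ) / (minAtom μ * (1 - maxCorr μ) ^ 3 * ζ ^ 2))) ∧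
      ∃ Φ Ψ, IsSimulation μ w ζ Φ Ψ by
    obtain ⟨w, hw, Φ, Ψ, H⟩ := h
    exact ⟨w, hw, H.exists_rounding⟩
  have hα := (minAtom_spec μ).1
  have hρ0 := maxCorr_nonneg μ
  have hzero : maxCorr μ < 1 → ((0 : ℕ) : ℝ) ≤ (512 * lindebergConst + 2) *
      ((1 + maxCorr μ) / (minAtom μ * (1 - maxCorr μ) ^ 3 * ζ ^ 2)) := fun h => by
    have : 0 < 1 - maxCorr μ := by linarith
    rw [Nat.cast_zero]
    positivity
  -- For ζ ≥ 1 zero functions suffice; the walk is needed only for ζ ≤ 1, which its parameter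
  -- estimates use.
  rcases le_total 1 ζ with hζ1 | hζ1
  · exact ⟨0, hzero, _, _, isSimulation_of_one_le μ hζ1⟩
  rcases hρ0.eq_or_lt with h0 | h0
  · exact ⟨0, hzero, _, _, isSimulation_of_maxCorr_eq_zero μ hζ.le h0.symm⟩
  rcases (maxCorr_le_one μ).eq_or_lt with h1 | h1
  · obtain ⟨w, H⟩ := exists_isSimulation_of_maxCorr_eq_one μ hζ hζ1 h1
    exact ⟨w, fun h => absurd h1 h.ne, H⟩
  · obtain ⟨w, hw, H⟩ := exists_isSimulation_of_maxCorr_lt_one μ hζ hζ1 h0 h1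
    exact ⟨w, fun _ => hw, H⟩
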